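/- Let $(W,S)$ be a Coxeter system with Coxeter matrix $(m_{st})$ and $W$ finite. Let $\mathfrak h^*=\bigoplus_{s\in S}\mathbb R\alpha_s$ be its geometric representation, with $(\alpha_s,\alpha_t)=-\cos(\pi/m_{st})$, $\langle\lambda,\alpha_s^\vee\rangle=2(\lambda,\alpha_s)/(\alpha_s,\alpha_s)$ and $s(\lambda)=\lambda-\langle\lambda,\alpha_s^\vee\rangle\alpha_s$. Let $R=\mathrm{Sym}(\mathfrak h^*)$ with the induced $W$-action, and let $R^W\subseteq R$ be the subalgebra of invariants. The nil Hecke algebra $\mathrm{nh}$ is the $\mathbb R$-algebra generated by the vector space $\mathfrak h^*$ and elements $\partial_s$ ($s\in S$), with relations $\lambda\mu=\mu\lambda$, $\partial_s\lambda=s(\lambda)\partial_s+\langle\lambda,\alpha_s^\vee\rangle$, $\partial_s^2=0$ and $\partial_s\partial_t\partial_s\cdots=\partial_t\partial_s\partial_t\cdots$ ($m_{st}$ factors on each side). Regard $\mathrm{nh}$ as a left $R$-module through $R\to\mathrm{nh}$, and write $s=1-\alpha_s\partial_s\in\mathrm{nh}$. A (left) bialgebroid structure on a ring $H\supseteq R$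 consists of left $R$-linear maps $\Delta:H\to H\otimes_R H$ (tensor product of left $R$-modules) and $\varepsilon:H\to R$ such that $(H,\Delta,\varepsilon)$ is a coassociative counital coalgebra; $\Delta$ is a ring homomorphism into the Takeuchi product $\{\sum h_i\otimes h_i' : \sum h_ir\otimes h_i'=\sum h_i\otimes h_i'r\ \forall r\in R\}$ with componentwise multiplication; and $h\cdot r=\varepsilon(hr)$ makes $R$ a left $H$-module extending the regular $R$-module. Then $H\text{-}\mathbf{Mod}$ is monoidal, with tensor product $M\otimes_R N$ on which $h(m\otimes n)=\sum h_{(1)}m\otimes h_{(2)}n$, and with unit $R$; if $\Delta$ is cocommutative, it is symmetric with the flip as braiding. Then the following hold. (1) There are an algebra homomorphism $\rho:\mathrm{nh}\to\mathrm{End}_{R^W}(R)$ with $\rho(\lambda)(f)=\lambda f$ and $\alpha_s\,\rho(\partial_s)(f)=f-s(f)$, and a cocommutative $R$-bialgebroid structure on $\mathrm{nh}$ with $\Delta(\lambda)=\lambda\otimes1$, $\Delta(\partial_s)=\partial_s\otimes s+1\otimes\partial_s$ and $\varepsilon(h)=\rho(h)(1)$. (Both are determined by these formulas.) (2) The map $\rho$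 is bijective and carries $\Delta$ to the comultiplication of the endomorphism algebra: if $\Delta(h)=\sum_i x_i\otimes y_i$, then $\rho(h)(fg)=\sum_i\rho(x_i)(f)\,\rho(y_i)(g)$ for all $f,g\in R$. (3) The functor $R\otimes_{R^W}-:R^W\text{-}\mathbf{Mod}\to\mathrm{nh}\text{-}\mathbf{Mod}$, where $\mathrm{nh}$ acts on the factor $R$ through $\rho$, is an equivalence of categories, and it is a (strong) symmetric monoidal functor from $(R^W\text{-}\mathbf{Mod},\otimes_{R^W})$ to $\mathrm{nh}\text{-}\mathbf{Mod}$ with the symmetric monoidal structure that comes from the bialgebroid structure in (1). -/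

import Mathlib

open CategoryTheory MonoidalCategory TensorProduct

universe u v

noncomputable section

section Takeuchi

variable {R H : Type*} [CommRing R] [Ring H] [Module R H]
variable {M N : Type*} [AddCommGroup M] [Module R M] [Module H M] [IsScalarTower R H M]
  [AddCommGroup N] [Module R N] [Module H N] [IsScalarTower R H N]

variable (R H) in
/-- The left `R`-linear map `h ↦ h • m`. -/
def orbitMap (m : M) : H →ₗ[R] M where
  toFun h := h • m
  map_add' := fun a b => add_smul a b m
  map_smul' := fun r a => smul_assoc r a m

@[simp] theorem orbitMap_apply (m : M) (h : H) : orbitMap R H m h = h • m := rfl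

theorem orbitMap_add (m m' : M) : orbitMap R H (m + m') = orbitMap R H m + orbitMap R H m' := by
  ext h; simp

variable [IsScalarTower R H H]

variable (R H) in
/-- The Takeuchi product `H ×_R H`: the elements `∑ hᵢ ⊗ hᵢ'` of the tensor product of left
`R`-modules such that `∑ hᵢ r ⊗ hᵢ' = ∑ hᵢ ⊗ hᵢ' r` for all `r`. The ring `R` maps to `H` by
`r ↦ r • 1`, which is a ring homomorphism because of `IsScalarTower R H H`. -/
def takeuchi : Submodule R (H ⊗[R] H) where
  carrier := {x | ∀ r : R, (LinearMap.mulRight R (r • (1 : H))).rTensor H x =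
    (LinearMap.mulRight R (r • (1 : H))).lTensor H x}
  zero_mem' r := by simp
  add_mem' hx hy r := by rw [map_add, map_add, hx r, hy r]
  smul_mem' c x hx r := by rw [map_smul, map_smul, hx r]

theorem orbitMap_smul (r : R) (m : M) :
    orbitMap R H (r • m) = orbitMap R H m ∘ₗ LinearMap.mulRight R (r • (1 : H)) := by
  ext h; simp [mul_smul]

/-- The action of the Takeuchi product on `M ⊗[R] N` for left `H`-modules `M` and `N`, given by
`(∑ hᵢ ⊗ hᵢ') (m ⊗ n) = ∑ hᵢ m ⊗ hᵢ' n`. For `M = N = H` it is the componentwise product. -/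
def takeuchiAct (x : takeuchi R H) : M ⊗[R] N →+ M ⊗[R] N :=
  TensorProduct.liftAddHom
    { toFun := fun m =>
        { toFun := fun n => TensorProduct.map (orbitMap R H m) (orbitMap R H n) x.1
          map_zero' := by
            have : orbitMap R H (0 : N) = 0 := by ext; simp
            simp [this]
          map_add' := fun n n' => by
            rw [orbitMap_add, TensorProduct.map_add_right, LinearMap.add_apply] }
      map_zero' := by
        have : orbitMap R H (0 : M) = 0 := by ext; simp
        ext; simp [this]
      map_add' := fun m m' => by
        ext n
        simp [orbitMap_add, TensorProduct.map_add_left] }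
    (fun r m n => by
      have h := congrArg (TensorProduct.map (orbitMap R H m) (orbitMap R H n)) (x.2 r)
      rw [← LinearMap.comp_apply, ← LinearMap.comp_apply, LinearMap.map_comp_rTensor,
        LinearMap.map_comp_lTensor, ← orbitMap_smul, ← orbitMap_smul] at h
      exact h)

@[simp] theorem takeuchiAct_tmul (x : takeuchi R H) (m : M) (n : N) :
    takeuchiAct x (m ⊗ₜ[R] n) = TensorProduct.map (orbitMap R H m) (orbitMap R H n) x.1 := rfl

end Takeuchi

/-- A left bialgebroid structure on `H` over the commutative ring `R`, where `R` maps to `H` by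
`r ↦ r • 1`; this map is injective by `counit_smul_one`. The comultiplication and the counit are
left `R`-linear and form a coassociative counital coalgebra, the comultiplication is a ring
homomorphism into the Takeuchi product, and `h ↦ (r ↦ ε (h r))` is a representation of `H` on `R`
that extends the regular representation of `R`. -/
structure Bialgebroid (R : Type*) (H : Type*) [CommRing R] [Ring H] [Module R H]
    [IsScalarTower R H H] extends Coalgebra R H where
  comul_mem : ∀ h, comul h ∈ takeuchi R H
  comul_one : comul 1 = 1 ⊗ₜ[R] 1
  comul_mul : ∀ g h, comul (g * h) = takeuchiAct ⟨comul g, comul_mem g⟩ (comul h)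
  counit_mul : ∀ g h (r : R), counit (g * h * (r • (1 : H))) =
    counit (g * (counit (h * (r • (1 : H))) • (1 : H)))
  counit_smul_one : ∀ r r' : R, counit ((r • (1 : H)) * (r' • (1 : H))) = r * r'

namespace Bialgebroid

/-- The comultiplication is invariant under the flip. -/
class IsCocomm {R H : Type*} [CommRing R] [Ring H] [Module R H]
    [IsScalarTower R H H] (bd : Bialgebroid R H) : Prop where
  comm_comul : ∀ h, TensorProduct.comm R H H (bd.comul h) = bd.comul h

section Unbundled

variable {R H : Type*} [CommRing R] [Ring H] [Module R H] [IsScalarTower R H H]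
  (bd : Bialgebroid R H)
variable (M N : Type*) [AddCommGroup M] [Module R M] [Module H M] [IsScalarTower R H M]
  [AddCommGroup N] [Module R N] [Module H N] [IsScalarTower R H N]

/-- The comultiplication as a map into the Takeuchi product. -/
def comulT (h : H) : takeuchi R H := ⟨bd.comul h, bd.comul_mem h⟩

theorem act_act (x : takeuchi R H) (y : H ⊗[R] H) (m : M) (n : N) :
    takeuchiAct x (TensorProduct.map (orbitMap R H m) (orbitMap R H n) y) =
      TensorProduct.map (orbitMap R H m) (orbitMap R H n) (takeuchiAct x y) := by
  induction y with
  | zero => simp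
  | add a b ha hb => simp only [map_add, ha, hb]
  | tmul a b =>
    simp only [map_tmul, takeuchiAct_tmul]
    rw [← LinearMap.comp_apply, ← TensorProduct.map_comp]
    congr 2 <;> · ext; simp [mul_smul]

/-- `M ⊗[R] N` as a left `H`-module: `h • (m ⊗ n) = ∑ h₍₁₎ m ⊗ h₍₂₎ n`. -/
abbrev tensorModule : Module H (M ⊗[R] N) where
  smul h z := takeuchiAct (bd.comulT h) z
  one_smul z := by
    change takeuchiAct (bd.comulT 1) z = z
    induction z with
    | zero => simp
    | add a b ha hb => rw [map_add, ha, hb]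
    | tmul a b => simp [comulT, bd.comul_one]
  mul_smul g h z := by
    change takeuchiAct (bd.comulT (g * h)) z =
      takeuchiAct (bd.comulT g) (takeuchiAct (bd.comulT h) z)
    induction z with
    | zero => simp
    | add a b ha hb => simp only [map_add, ha, hb]
    | tmul a b =>
      simp only [takeuchiAct_tmul]
      rw [act_act]
      simp only [comulT, bd.comul_mul]
  smul_zero h := map_zero _
  smul_add h := map_add _
  add_smul g h z := by
    change takeuchiAct (bd.comulT (g + h)) z =
      takeuchiAct (bd.comulT g) z + takeuchiAct (bd.comulT h) z
    induction z with
    | zero => simp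
    | add a b ha hb => simp only [map_add, ha, hb]; abel
    | tmul a b => simp [comulT]
  zero_smul z := by
    change takeuchiAct (bd.comulT 0) z = 0
    induction z with
    | zero => simp
    | add a b ha hb => simp only [map_add, ha, hb, add_zero]
    | tmul a b => simp [comulT]

/-- `R` as a left `H`-module: `h • r = ε (h r)`. -/
abbrev unitModule : Module H R where
  smul h r := bd.counit (h * (r • (1 : H)))
  one_smul r := by
    change bd.counit (1 * (r • (1 : H))) = r
    simpa using bd.counit_smul_one 1 r
  mul_smul g h r := bd.counit_mul g h r
  smul_zero h := by
    change bd.counit (h * ((0 : R) • (1 : H))) = 0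
    simp
  smul_add h r r' := by
    change bd.counit (h * ((r + r') • (1 : H))) =
      bd.counit (h * (r • (1 : H))) + bd.counit (h * (r' • (1 : H)))
    rw [add_smul, mul_add, map_add]
  add_smul g h r := by
    change bd.counit ((g + h) * (r • (1 : H))) =
      bd.counit (g * (r • (1 : H))) + bd.counit (h * (r • (1 : H)))
    rw [add_mul, map_add]
  zero_smul r := by
    change bd.counit (0 * (r • (1 : H))) = 0
    simp

end Unbundled

end Bialgebroid

namespace Bialgebroid

section Category

variable {R H : Type u} [CommRing R] [Ring H] [Module R H] [IsScalarTower R H H]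

/-- The category of left `H`-modules; this copy carries the monoidal structure that comes from the
bialgebroid structure `bd`. -/
def Mod (_bd : Bialgebroid R H) : Type (u + 1) := ModuleCat.{u} H

/-- The underlying `H`-module. -/
def Mod.mod {bd : Bialgebroid R H} (X : bd.Mod) : ModuleCat.{u} H := X

variable (bd : Bialgebroid R H)

instance : Category bd.Mod := inferInstanceAs (Category (ModuleCat.{u} H))

/-- Restriction along `R → H`. -/
def res : bd.Mod ⥤ ModuleCat.{u} R :=
  ModuleCat.restrictScalars (RingHom.smulOneHom : R →+* H)

instance : bd.res.Faithful :=
  inferInstanceAs (ModuleCat.restrictScalars (RingHom.smulOneHom : R →+* H)).Faithful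

instance (X : bd.Mod) : Module H (bd.res.obj X) :=
  inferInstanceAs (Module H X.mod)

instance (X : bd.Mod) : IsScalarTower R H (bd.res.obj X) where
  smul_assoc r h x := by
    change (r • h) • x = (r • (1 : H)) • (h • x)
    rw [← mul_smul, smul_one_mul]

/-- An `R`-linear map between `H`-modules that commutes with `H`, as a morphism. -/
def liftHom {X Y : bd.Mod} (f : bd.res.obj X ⟶ bd.res.obj Y)
    (hf : ∀ (h : H) (x : bd.res.obj X), f (h • x) = h • f x) : X ⟶ Y :=
  ModuleCat.ofHom (X := X.mod) (Y := Y.mod)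
    { toFun := fun x => f x
      map_add' := fun x y => f.hom.map_add x y
      map_smul' := hf }

theorem res_map_liftHom {X Y : bd.Mod} (f : bd.res.obj X ⟶ bd.res.obj Y)
    (hf : ∀ (h : H) (x : bd.res.obj X), f (h • x) = h • f x) :
    bd.res.map (bd.liftHom f hf) = f := rfl

/-- An `R`-linear isomorphism between `H`-modules that commutes with `H`, as an isomorphism. -/
def liftIso {X Y : bd.Mod} (e : bd.res.obj X ≅ bd.res.obj Y)
    (he : ∀ (h : H) (x : bd.res.obj X), e.hom (h • x) = h • e.hom x) : X ≅ Y where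
  hom := bd.liftHom e.hom he
  inv := bd.liftHom e.inv (fun h y => by
    have := he h (e.inv y)
    have h2 : ∀ z, e.hom (e.inv z) = z := fun z => by
      rw [← ModuleCat.comp_apply, e.inv_hom_id]; rfl
    have h3 : ∀ z, e.inv (e.hom z) = z := fun z => by
      rw [← ModuleCat.comp_apply, e.hom_inv_id]; rfl
    rw [h2] at this
    rw [← this, h3])
  hom_inv_id := bd.res.map_injective (by
    rw [Functor.map_comp, res_map_liftHom, res_map_liftHom, e.hom_inv_id, CategoryTheory.Functor.map_id])
  inv_hom_id := bd.res.map_injective (by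
    rw [Functor.map_comp, res_map_liftHom, res_map_liftHom, e.inv_hom_id, CategoryTheory.Functor.map_id])

/-- `M ⊗[R] N` with `H` acting through the comultiplication. -/
def tensorObj (X Y : bd.Mod) : bd.Mod :=
  letI := bd.tensorModule (bd.res.obj X) (bd.res.obj Y)
  ModuleCat.of H (bd.res.obj X ⊗[R] bd.res.obj Y)

/-- `R` with `H` acting by `h • r = ε (h r)`. -/
def unitObj : bd.Mod :=
  letI := bd.unitModule
  ModuleCat.of H R

/-- The `R`-action on `M ⊗[R] N` obtained through `H` is the usual one. -/
def tensorResEquiv (X Y : bd.Mod) :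
    (bd.res.obj X ⊗[R] bd.res.obj Y) ≃ₗ[R] bd.res.obj (bd.tensorObj X Y) where
  toFun z := z
  invFun z := z
  left_inv _ := rfl
  right_inv _ := rfl
  map_add' _ _ := rfl
  map_smul' r z := by
    change r • z = takeuchiAct (bd.comulT (r • (1 : H))) z
    induction z with
    | zero => simp
    | add a b ha hb => rw [smul_add, map_add, ha, hb]
    | tmul a b => simp [comulT, bd.comul_one]

/-- The `R`-action on the unit object obtained through `H` is the regular one. -/
def unitResEquiv : R ≃ₗ[R] bd.res.obj bd.unitObj where
  toFun z := z
  invFun z := z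
  left_inv _ := rfl
  right_inv _ := rfl
  map_add' _ _ := rfl
  map_smul' r z := by
    change r * z = bd.counit ((r • (1 : H)) * (z • (1 : H)))
    rw [bd.counit_smul_one]

def tensorResIso (X Y : bd.Mod) :
    bd.res.obj X ⊗ bd.res.obj Y ≅ bd.res.obj (bd.tensorObj X Y) :=
  (bd.tensorResEquiv X Y).toModuleIso

def unitResIso : 𝟙_ (ModuleCat.{u} R) ≅ bd.res.obj bd.unitObj :=
  bd.unitResEquiv.toModuleIso

theorem smul_tensorResIso (X Y : bd.Mod) (h : H) (x : bd.res.obj X) (y : bd.res.obj Y) :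
    h • (bd.tensorResIso X Y).hom (x ⊗ₜ[R] y) =
      (bd.tensorResIso X Y).hom
        (TensorProduct.map (orbitMap R H x) (orbitMap R H y) (bd.comul h)) := rfl

theorem tensor_equivariant {X Y Z : bd.Mod} (f : bd.res.obj (bd.tensorObj X Y) ⟶ bd.res.obj Z)
    (hf : ∀ (h : H) (x : bd.res.obj X) (y : bd.res.obj Y),
      f (h • (bd.tensorResIso X Y).hom (x ⊗ₜ[R] y)) =
        h • f ((bd.tensorResIso X Y).hom (x ⊗ₜ[R] y)))
    (h : H) (z : bd.res.obj (bd.tensorObj X Y)) : f (h • z) = h • f z := by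
  have key : ∀ w : bd.res.obj X ⊗[R] bd.res.obj Y,
      f (h • (bd.tensorResIso X Y).hom w) = h • f ((bd.tensorResIso X Y).hom w) := by
    intro w
    induction w with
    | zero =>
      have h0 : (bd.tensorResIso X Y).hom (0 : bd.res.obj X ⊗[R] bd.res.obj Y) = 0 :=
        map_zero (bd.tensorResIso X Y).hom.hom
      rw [h0, smul_zero, map_zero, smul_zero]
    | add a b ha hb =>
      have h0 : (bd.tensorResIso X Y).hom (a + b) =
        (bd.tensorResIso X Y).hom a + (bd.tensorResIso X Y).hom b :=
        map_add (bd.tensorResIso X Y).hom.hom a b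
      rw [h0, smul_add, map_add, map_add, ha, hb, smul_add]
    | tmul a b => exact hf h a b
  exact key z

end Category

end Bialgebroid

namespace Bialgebroid

section Monoidal

variable {R H : Type u} [CommRing R] [Ring H] [Module R H] [IsScalarTower R H H]
variable (bd : Bialgebroid R H)

theorem map_equivariant {X Y : bd.Mod} (f : X ⟶ Y) (h : H) (x : bd.res.obj X) :
    bd.res.map f (h • x) = h • bd.res.map f x :=
  (show X.mod ⟶ Y.mod from f).hom.map_smul h x

theorem tensorHom_equivariant {X Y X' Y' : bd.Mod} (f : bd.res.obj X ⟶ bd.res.obj X')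
    (g : bd.res.obj Y ⟶ bd.res.obj Y')
    (hf : ∀ (h : H) (x : bd.res.obj X), f (h • x) = h • f x)
    (hg : ∀ (h : H) (y : bd.res.obj Y), g (h • y) = h • g y) :
    ∀ (h : H) (z : bd.res.obj (bd.tensorObj X Y)),
      ((bd.tensorResIso X Y).inv ≫ (f ⊗ₘ g) ≫ (bd.tensorResIso X' Y').hom) (h • z) =
        h • ((bd.tensorResIso X Y).inv ≫ (f ⊗ₘ g) ≫ (bd.tensorResIso X' Y').hom) z :=
  bd.tensor_equivariant _ (fun h x y => by
    change TensorProduct.map f.hom g.hom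
        (TensorProduct.map (orbitMap R H x) (orbitMap R H y) (bd.comul h)) =
      TensorProduct.map (orbitMap R H (f x)) (orbitMap R H (g y)) (bd.comul h)
    rw [← LinearMap.comp_apply, ← TensorProduct.map_comp]
    congr 2
    · ext a; exact hf a x
    · ext a; exact hg a y)

theorem orbitMap_tmul (X Y : bd.Mod) (x : bd.res.obj X) (y : bd.res.obj Y) :
    orbitMap R H ((bd.tensorResIso X Y).hom (x ⊗ₜ[R] y)) =
      (bd.tensorResEquiv X Y).toLinearMap ∘ₗ
        TensorProduct.map (orbitMap R H x) (orbitMap R H y) ∘ₗ bd.comul := rfl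

theorem associator_hom_eq (X Y Z : bd.Mod) :
    (((bd.tensorResIso _ _).symm ≪≫ ((bd.tensorResIso _ _).symm ⊗ᵢ .refl _))
        ≪≫ α_ (bd.res.obj X) (bd.res.obj Y) (bd.res.obj Z)
        ≪≫ ((.refl _ ⊗ᵢ bd.tensorResIso _ _) ≪≫ bd.tensorResIso _ _)).hom.hom =
      (bd.tensorResEquiv X (bd.tensorObj Y Z)).toLinearMap ∘ₗ
        TensorProduct.map LinearMap.id (bd.tensorResEquiv Y Z).toLinearMap ∘ₗ
        (TensorProduct.assoc R (bd.res.obj X) (bd.res.obj Y) (bd.res.obj Z)).toLinearMap ∘ₗ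
        TensorProduct.map (bd.tensorResEquiv X Y).symm.toLinearMap LinearMap.id ∘ₗ
        (bd.tensorResEquiv (bd.tensorObj X Y) Z).symm.toLinearMap := rfl

theorem smul_tensorResEquiv (X Y : bd.Mod) (h : H) (x : bd.res.obj X) (y : bd.res.obj Y) :
    h • bd.tensorResEquiv X Y (x ⊗ₜ[R] y) =
      bd.tensorResEquiv X Y
        (TensorProduct.map (orbitMap R H x) (orbitMap R H y) (bd.comul h)) := rfl

theorem associator_equivariant (X Y Z : bd.Mod) :
    ∀ (h : H) (w : bd.res.obj (bd.tensorObj (bd.tensorObj X Y) Z)),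
      (((bd.tensorResIso _ _).symm ≪≫ ((bd.tensorResIso _ _).symm ⊗ᵢ .refl _))
        ≪≫ α_ (bd.res.obj X) (bd.res.obj Y) (bd.res.obj Z)
        ≪≫ ((.refl _ ⊗ᵢ bd.tensorResIso _ _) ≪≫ bd.tensorResIso _ _)).hom (h • w) =
      h • (((bd.tensorResIso _ _).symm ≪≫ ((bd.tensorResIso _ _).symm ⊗ᵢ .refl _))
        ≪≫ α_ (bd.res.obj X) (bd.res.obj Y) (bd.res.obj Z)
        ≪≫ ((.refl _ ⊗ᵢ bd.tensorResIso _ _) ≪≫ bd.tensorResIso _ _)).hom w :=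
  bd.tensor_equivariant _ (fun h v z => by
    obtain ⟨v, rfl⟩ := (bd.tensorResEquiv X Y).surjective v
    induction v with
    | zero => simp only [map_zero, TensorProduct.zero_tmul, smul_zero]
    | add a b ha hb =>
      simp only [map_add, TensorProduct.add_tmul, smul_add] at ha hb ⊢
      rw [ha, hb]
    | tmul x y =>
      have key : TensorProduct.assoc R _ _ _
          (TensorProduct.map (TensorProduct.map (orbitMap R H x) (orbitMap R H y) ∘ₗ bd.comul)
            (orbitMap R H z) (bd.comul h)) =
          TensorProduct.map (orbitMap R H x)
            (TensorProduct.map (orbitMap R H y) (orbitMap R H z) ∘ₗ bd.comul) (bd.comul h) := by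
        have h1 := bd.coassoc_apply h
        have h2 := congrArg (TensorProduct.map (orbitMap R H x)
          (TensorProduct.map (orbitMap R H y) (orbitMap R H z))) h1
        rw [LinearMap.map_lTensor] at h2
        rw [← h2, TensorProduct.map_map_assoc, LinearMap.map_rTensor]
      have e1 : (bd.tensorResEquiv X Y).symm.toLinearMap ∘ₗ
          orbitMap R H ((bd.tensorResEquiv X Y) (x ⊗ₜ[R] y)) =
          TensorProduct.map (orbitMap R H x) (orbitMap R H y) ∘ₗ bd.comul := rfl
      have e2 : (bd.tensorResEquiv Y Z).toLinearMap ∘ₗ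
          TensorProduct.map (orbitMap R H y) (orbitMap R H z) ∘ₗ bd.comul =
          orbitMap R H ((bd.tensorResEquiv Y Z) (y ⊗ₜ[R] z)) := rfl
      have e3 : ∀ w, (bd.tensorResIso (bd.tensorObj X Y) Z).hom w =
        bd.tensorResEquiv (bd.tensorObj X Y) Z w := fun _ => rfl
      rw [e3, smul_tensorResEquiv]
      change ModuleCat.Hom.hom _ _ = h • ModuleCat.Hom.hom _ _
      rw [associator_hom_eq]
      simp only [LinearMap.comp_apply, LinearEquiv.coe_coe, LinearEquiv.symm_apply_apply,
        TensorProduct.map_tmul, TensorProduct.assoc_tmul, LinearMap.id_apply]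
      rw [smul_tensorResEquiv, ← LinearMap.comp_apply
        (TensorProduct.map (bd.tensorResEquiv X Y).symm.toLinearMap _),
        ← TensorProduct.map_comp, e1, LinearMap.id_comp, key, ← LinearMap.comp_apply,
        ← TensorProduct.map_comp, LinearMap.id_comp, e2])

theorem leftUnitor_equivariant (X : bd.Mod) :
    ∀ (h : H) (w : bd.res.obj (bd.tensorObj bd.unitObj X)),
      (((bd.tensorResIso _ _).symm ≪≫ (bd.unitResIso.symm ⊗ᵢ .refl _))
        ≪≫ λ_ (bd.res.obj X)).hom (h • w) =
      h • (((bd.tensorResIso _ _).symm ≪≫ (bd.unitResIso.symm ⊗ᵢ .refl _))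
        ≪≫ λ_ (bd.res.obj X)).hom w :=
  bd.tensor_equivariant _ (fun h r x => by
    obtain ⟨r, rfl⟩ := bd.unitResEquiv.surjective r
    have e1 : bd.unitResEquiv.symm.toLinearMap ∘ₗ orbitMap R H (bd.unitResEquiv r) =
        bd.counit ∘ₗ LinearMap.mulRight R (r • (1 : H)) := rfl
    change TensorProduct.lid R _ (TensorProduct.map bd.unitResEquiv.symm.toLinearMap LinearMap.id
      (TensorProduct.map (orbitMap R H (bd.unitResEquiv r)) (orbitMap R H x) (bd.comul h))) =
      h • (r • x)
    rw [← LinearMap.comp_apply (TensorProduct.map bd.unitResEquiv.symm.toLinearMap _),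
      ← TensorProduct.map_comp, e1, LinearMap.id_comp]
    have h1 := bd.comul_mem h r
    have h2 := congrArg (TensorProduct.map bd.counit (orbitMap R H x)) h1
    rw [LinearMap.map_rTensor, LinearMap.map_lTensor, ← orbitMap_smul] at h2
    rw [h2]
    have h3 : TensorProduct.map bd.counit (orbitMap R H (r • x)) =
        (orbitMap R H (r • x)).lTensor R ∘ₗ bd.counit.rTensor H := by
      rw [LinearMap.lTensor_comp_rTensor]
    rw [h3, LinearMap.comp_apply, bd.rTensor_counit_comul]
    simp)

theorem rightUnitor_equivariant (X : bd.Mod) :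
    ∀ (h : H) (w : bd.res.obj (bd.tensorObj X bd.unitObj)),
      (((bd.tensorResIso _ _).symm ≪≫ (.refl _ ⊗ᵢ bd.unitResIso.symm))
        ≪≫ ρ_ (bd.res.obj X)).hom (h • w) =
      h • (((bd.tensorResIso _ _).symm ≪≫ (.refl _ ⊗ᵢ bd.unitResIso.symm))
        ≪≫ ρ_ (bd.res.obj X)).hom w :=
  bd.tensor_equivariant _ (fun h x r => by
    obtain ⟨r, rfl⟩ := bd.unitResEquiv.surjective r
    have e1 : bd.unitResEquiv.symm.toLinearMap ∘ₗ orbitMap R H (bd.unitResEquiv r) =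
        bd.counit ∘ₗ LinearMap.mulRight R (r • (1 : H)) := rfl
    change TensorProduct.rid R _ (TensorProduct.map LinearMap.id bd.unitResEquiv.symm.toLinearMap
      (TensorProduct.map (orbitMap R H x) (orbitMap R H (bd.unitResEquiv r)) (bd.comul h))) =
      h • (r • x)
    rw [← LinearMap.comp_apply (TensorProduct.map _ bd.unitResEquiv.symm.toLinearMap),
      ← TensorProduct.map_comp, e1, LinearMap.id_comp]
    have h1 := bd.comul_mem h r
    have h2 := congrArg (TensorProduct.map (orbitMap R H x) bd.counit) h1
    rw [LinearMap.map_rTensor, LinearMap.map_lTensor, ← orbitMap_smul] at h2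
    rw [← h2]
    have h3 : TensorProduct.map (orbitMap R H (r • x)) bd.counit =
        (orbitMap R H (r • x)).rTensor R ∘ₗ bd.counit.lTensor H := by
      rw [LinearMap.rTensor_comp_lTensor]
    rw [h3, LinearMap.comp_apply, bd.lTensor_counit_comul]
    simp)

theorem braiding_equivariant [bd.IsCocomm] (X Y : bd.Mod) :
    ∀ (h : H) (w : bd.res.obj (bd.tensorObj X Y)),
      ((bd.tensorResIso _ _).symm ≪≫ β_ (bd.res.obj X) (bd.res.obj Y) ≪≫
        bd.tensorResIso _ _).hom (h • w) =
      h • ((bd.tensorResIso _ _).symm ≪≫ β_ (bd.res.obj X) (bd.res.obj Y) ≪≫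
        bd.tensorResIso _ _).hom w :=
  bd.tensor_equivariant _ (fun h x y => by
    change TensorProduct.comm R _ _
        (TensorProduct.map (orbitMap R H x) (orbitMap R H y) (bd.comul h)) =
      TensorProduct.map (orbitMap R H y) (orbitMap R H x) (bd.comul h)
    rw [← TensorProduct.map_comm, IsCocomm.comm_comul])

/-- Tensor product `M ⊗[R] N`, unit `R`; the structure morphisms are those of `R`-modules. -/
instance : MonoidalCategoryStruct bd.Mod where
  tensorObj := bd.tensorObj
  tensorUnit := bd.unitObj
  tensorHom f g := bd.liftHom _
    (bd.tensorHom_equivariant (bd.res.map f) (bd.res.map g)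
      (bd.map_equivariant f) (bd.map_equivariant g))
  whiskerLeft X _ _ g := bd.liftHom _
    (bd.tensorHom_equivariant (𝟙 (bd.res.obj X)) (bd.res.map g)
      (fun _ _ => rfl) (bd.map_equivariant g))
  whiskerRight f Y := bd.liftHom _
    (bd.tensorHom_equivariant (bd.res.map f) (𝟙 (bd.res.obj Y))
      (bd.map_equivariant f) (fun _ _ => rfl))
  associator X Y Z := bd.liftIso _ (bd.associator_equivariant X Y Z)
  leftUnitor X := bd.liftIso _ (bd.leftUnitor_equivariant X)
  rightUnitor X := bd.liftIso _ (bd.rightUnitor_equivariant X)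

def inducingData : Monoidal.InducingFunctorData bd.res where
  μIso := bd.tensorResIso
  εIso := bd.unitResIso
  whiskerLeft_eq X _ _ f := by rw [← id_tensorHom]; rfl
  whiskerRight_eq f Y := by rw [← tensorHom_id]; rfl
  tensorHom_eq _ _ := rfl
  associator_eq _ _ _ := rfl
  leftUnitor_eq _ := rfl
  rightUnitor_eq _ := rfl

instance : MonoidalCategory bd.Mod := Monoidal.induced bd.res bd.inducingData

instance : bd.res.Monoidal := Monoidal.fromInducedMonoidal bd.res bd.inducingData

/-- The braiding is the flip `m ⊗ n ↦ n ⊗ m`. -/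
instance [bd.IsCocomm] : BraidedCategory bd.Mod :=
  .ofFaithful bd.res (fun X Y => bd.liftIso _ (bd.braiding_equivariant X Y)) (fun X Y => by
    change (bd.tensorResIso X Y).hom ≫ (bd.tensorResIso X Y).inv ≫
      (β_ (bd.res.obj X) (bd.res.obj Y)).hom ≫ (bd.tensorResIso Y X).hom =
      (β_ (bd.res.obj X) (bd.res.obj Y)).hom ≫ (bd.tensorResIso Y X).hom
    rw [Iso.hom_inv_id_assoc])

instance [bd.IsCocomm] : bd.res.Braided where
  braided X Y := by
    change (bd.tensorResIso X Y).hom ≫ (bd.tensorResIso X Y).inv ≫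
      (β_ (bd.res.obj X) (bd.res.obj Y)).hom ≫ (bd.tensorResIso Y X).hom =
      (β_ (bd.res.obj X) (bd.res.obj Y)).hom ≫ (bd.tensorResIso Y X).hom
    rw [Iso.hom_inv_id_assoc]

instance [bd.IsCocomm] : SymmetricCategory bd.Mod := .ofFaithful bd.res

end Monoidal

end Bialgebroid

section Coxeter

variable {B : Type u} (M : CoxeterMatrix B)

/-- `(αₛ, αₜ) = -cos (π / mₛₜ)`; for `mₛₜ = ∞`, which `CoxeterMatrix` encodes as `0`, this is `-1`. -/
def rootForm : (B →₀ ℝ) →ₗ[ℝ] (B →₀ ℝ) →ₗ[ℝ] ℝ :=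
  Finsupp.linearCombination ℝ fun s =>
    Finsupp.linearCombination ℝ fun t => -Real.cos (Real.pi / M s t)

/-- The simple root `αₛ`. -/
def simpleRoot (s : B) : B →₀ ℝ := Finsupp.single s 1

/-- `⟨lam, αₛ^∨⟩ = 2 (lam, αₛ) / (αₛ, αₛ)`, as a linear form in `lam`. -/
def coroot (s : B) : (B →₀ ℝ) →ₗ[ℝ] ℝ :=
  (2 / rootForm M (simpleRoot s) (simpleRoot s)) • (rootForm M).flip (simpleRoot s)

/-- `s(lam) = lam - ⟨lam, αₛ^∨⟩ αₛ`. -/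
def simpleReflection (s : B) : Module.End ℝ (B →₀ ℝ) :=
  Module.preReflection (simpleRoot s) (coroot M s)

theorem coroot_simpleRoot (s t : B) :
    coroot M s (simpleRoot t) = -2 * Real.cos (Real.pi / M s t) := by
  simp [coroot, rootForm, simpleRoot, M.symmetric t s]

theorem coroot_simpleRoot_self (s : B) : coroot M s (simpleRoot s) = 2 := by
  simp [coroot_simpleRoot]

theorem simpleReflection_eq (s : B) :
    simpleReflection M s = (Module.reflection (coroot_simpleRoot_self M s)).toLinearMap := rfl

open Polynomial.Chebyshev in
theorem simpleReflection_isLiftable : M.IsLiftable (simpleReflection M) := by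
  intro s t
  have hmul : (simpleReflection M s * simpleReflection M t) ^ M s t =
      (((Module.reflection (coroot_simpleRoot_self M s)) *
        (Module.reflection (coroot_simpleRoot_self M t))) ^ M s t).toLinearMap := by
    rw [simpleReflection_eq, simpleReflection_eq]
    generalize M s t = n
    induction n with
    | zero => rfl
    | succ n ih => rw [pow_succ, pow_succ, ih]; rfl
  rw [hmul]
  have hc1 := coroot_simpleRoot M s t
  have hc2 := coroot_simpleRoot M t s
  rw [M.symmetric t s] at hc2
  refine LinearMap.ext fun z => ?_
  change ((Module.reflection (coroot_simpleRoot_self M s) *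
    Module.reflection (coroot_simpleRoot_self M t)) ^ M s t) z = z
  rcases eq_or_ne s t with rfl | hst
  · rw [M.diagonal, pow_one]
    exact Module.involutive_reflection (coroot_simpleRoot_self M s) z
  have hm1 : M s t ≠ 1 := M.off_diagonal s t hst
  generalize M s t = m at hc1 hc2 hm1
  rcases Nat.lt_or_ge m 3 with hlt | hge
  · interval_cases m
    · rfl
    · exact absurd rfl hm1
    · have h1 : coroot M s (simpleRoot t) = 0 := by rw [hc1]; simp
      have h2 : coroot M t (simpleRoot s) = 0 := by rw [hc2]; simp
      have h3 := coroot_simpleRoot_self M s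
      have h4 := coroot_simpleRoot_self M t
      simp only [pow_two, LinearEquiv.mul_apply, Module.reflection_apply, map_sub, map_smul,
        h1, h2, h3, h4]
      module
  have hmpos : (0 : ℝ) < m := by exact_mod_cast (by omega : 0 < m)
  have hge' : (3 : ℝ) ≤ m := by exact_mod_cast hge
  set θ : ℝ := 2 * Real.pi / m with hθ
  have hmθ : m * θ = 2 * Real.pi := by rw [hθ]; field_simp
  have hsin : Real.sin θ ≠ 0 := by
    refine (Real.sin_pos_of_pos_of_lt_pi (by positivity) ?_).ne'
    nlinarith [Real.pi_pos]
  have ht : 2 * Real.cos θ =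
      coroot M s (simpleRoot t) * coroot M t (simpleRoot s) - 2 := by
    have : θ = 2 * (Real.pi / m) := by rw [hθ]; ring
    rw [hc1, hc2, this, Real.cos_two_mul]; ring
  have hS : ∀ n : ℤ, (S ℝ n).eval (2 * Real.cos θ) = Real.sin ((n + 1) * θ) / Real.sin θ :=
    fun n => eq_div_of_mul_eq hsin (S_two_mul_real_cos θ n)
  rw [Module.reflection_mul_reflection_pow_apply _ _ m z (2 * Real.cos θ) ht]
  obtain ⟨k, hk | hk⟩ := m.even_or_odd'
  · have i1 : ((m : ℤ) - 2) / 2 = k - 1 := by omega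
    have i2 : ((m : ℤ) - 1) / 2 = k - 1 := by omega
    have hz : (S ℝ ((k : ℤ) - 1)).eval (2 * Real.cos θ) = 0 := by
      rw [hS]
      have : (((k : ℤ) - 1 : ℤ) + 1 : ℝ) * θ = Real.pi := by
        rw [hk] at hmθ; push_cast at hmθ ⊢; linarith
      rw [this]; simp
    rw [i1, i2, hz]; simp
  · have i1 : ((m : ℤ) - 2) / 2 = k - 1 := by omega
    have i2 : ((m : ℤ) - 1) / 2 = k := by omega
    have i3 : ((m : ℤ) - 3) / 2 = k - 1 := by omega
    have i4 : (m : ℤ) / 2 = k := by omega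
    have hz : (S ℝ (k : ℤ)).eval (2 * Real.cos θ) +
        (S ℝ ((k : ℤ) - 1)).eval (2 * Real.cos θ) = 0 := by
      rw [hS, hS, ← add_div]
      have : (((k : ℤ) - 1 : ℤ) + 1 : ℝ) * θ = 2 * Real.pi - (((k : ℤ) + 1) * θ : ℝ) := by
        rw [hk] at hmθ; push_cast at hmθ ⊢; linarith
      rw [this, Real.sin_two_pi_sub]; simp
    rw [i1, i2, i3, i4, hz]; simp

variable {M} {W : Type v} [Group W] (cs : CoxeterSystem M W)

/-- The geometric representation of `W` on `𝔥* = ⊕ₛ ℝ αₛ`. -/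
def geomRep : Representation ℝ W (B →₀ ℝ) :=
  cs.lift ⟨simpleReflection M, simpleReflection_isLiftable M⟩

theorem geomRep_simple (s : B) : geomRep cs (cs.simple s) = simpleReflection M s :=
  cs.lift_apply_simple _ s

variable (B) in
/-- `R = Sym(𝔥*)`. -/
abbrev SymR : Type u := SymmetricAlgebra ℝ (B →₀ ℝ)

/-- The action of `W` on `R` by algebra endomorphisms induced from the geometric representation. -/
def symAction : W →* (SymR B →ₐ[ℝ] SymR B) where
  toFun w := SymmetricAlgebra.lift (SymmetricAlgebra.ι ℝ (B →₀ ℝ) ∘ₗ geomRep cs w)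
  map_one' := by
    rw [map_one]
    exact SymmetricAlgebra.lift_ι
  map_mul' w w' := by
    apply SymmetricAlgebra.algHom_ext
    refine LinearMap.ext fun x => ?_
    simp [AlgHom.mul_apply, Module.End.mul_apply]

/-- `R^W`. -/
def invariants : Subalgebra ℝ (SymR B) where
  carrier := {f | ∀ w : W, symAction cs w f = f}
  mul_mem' ha hb w := by rw [map_mul, ha w, hb w]
  add_mem' ha hb w := by rw [map_add, ha w, hb w]
  algebraMap_mem' r w := AlgHom.commutes _ r

section NilHecke

/-- `a b a ⋯` with `n` factors. -/
def altProd {A : Type*} [Monoid A] (a b : A) : ℕ → A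
  | 0 => 1
  | n + 1 => a * altProd b a n

variable (M)

/-- The defining relations of the nil Hecke algebra. The generators are the weights in `𝔥*`
(`Sum.inl`; the first two relations make them depend linearly on the weight) and the `∂ₛ`
(`Sum.inr`). For `mₛₜ = ∞`, encoded as `0`, the braid relation is `1 = 1`. -/
inductive NilHeckeRel :
    FreeAlgebra ℝ ((B →₀ ℝ) ⊕ B) → FreeAlgebra ℝ ((B →₀ ℝ) ⊕ B) → Prop
  | add (l m : B →₀ ℝ) : NilHeckeRel (.ι ℝ (.inl (l + m))) (.ι ℝ (.inl l) + .ι ℝ (.inl m))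
  | smul (c : ℝ) (l : B →₀ ℝ) : NilHeckeRel (.ι ℝ (.inl (c • l))) (c • .ι ℝ (.inl l))
  | comm (l m : B →₀ ℝ) :
      NilHeckeRel (.ι ℝ (.inl l) * .ι ℝ (.inl m)) (.ι ℝ (.inl m) * .ι ℝ (.inl l))
  | weyl (s : B) (l : B →₀ ℝ) :
      NilHeckeRel (.ι ℝ (.inr s) * .ι ℝ (.inl l))
        (.ι ℝ (.inl (simpleReflection M s l)) * .ι ℝ (.inr s) + algebraMap ℝ _ (coroot M s l))
  | sq (s : B) : NilHeckeRel (.ι ℝ (.inr s) * .ι ℝ (.inr s)) 0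
  | braid (s t : B) :
      NilHeckeRel (altProd (.ι ℝ (.inr s)) (.ι ℝ (.inr t)) (M s t))
        (altProd (.ι ℝ (.inr t)) (.ι ℝ (.inr s)) (M s t))

/-- The nil Hecke algebra. -/
def NilHecke : Type u := RingQuot (NilHeckeRel M)

instance : Ring (NilHecke M) := inferInstanceAs (Ring (RingQuot (NilHeckeRel M)))
instance : Algebra ℝ (NilHecke M) := inferInstanceAs (Algebra ℝ (RingQuot (NilHeckeRel M)))

namespace NilHecke

/-- The quotient map from the free algebra. -/
def mk : FreeAlgebra ℝ ((B →₀ ℝ) ⊕ B) →ₐ[ℝ] NilHecke M := RingQuot.mkAlgHom ℝ (NilHeckeRel M)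

theorem mk_rel {x y : FreeAlgebra ℝ ((B →₀ ℝ) ⊕ B)} (h : NilHeckeRel M x y) :
    mk M x = mk M y :=
  RingQuot.mkAlgHom_rel ℝ h

/-- The weights `𝔥* → nh`. -/
def weight : (B →₀ ℝ) →ₗ[ℝ] NilHecke M where
  toFun l := mk M (.ι ℝ (.inl l))
  map_add' l m := by rw [← map_add, mk_rel M (.add l m)]
  map_smul' c l := by rw [RingHom.id_apply, ← map_smul, mk_rel M (.smul c l)]

/-- The nil Coxeter generator `∂ₛ`. -/
def del (s : B) : NilHecke M := mk M (.ι ℝ (.inr s))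

theorem weight_comm (l m : B →₀ ℝ) : weight M l * weight M m = weight M m * weight M l := by
  change mk M _ * mk M _ = mk M _ * mk M _
  rw [← map_mul, ← map_mul, mk_rel M (.comm l m)]

theorem weight_comm_range : ∀ a ∈ Set.range (weight M), ∀ b ∈ Set.range (weight M),
    a * b = b * a := by
  rintro _ ⟨l, rfl⟩ _ ⟨m, rfl⟩
  exact weight_comm M l m

/-- The algebra map `R → nh` extending `𝔥* → nh`. -/
def ofSym : SymR B →ₐ[ℝ] NilHecke M :=
  letI : CommRing (Algebra.adjoin ℝ (Set.range (weight M))) :=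
    { (Algebra.adjoin ℝ (Set.range (weight M))).toRing with
      mul_comm := (Algebra.isMulCommutative_adjoin ℝ (weight_comm_range M)).is_comm.comm }
  (Algebra.adjoin ℝ (Set.range (weight M))).val.comp
    (SymmetricAlgebra.lift ((weight M).codRestrict
      (Subalgebra.toSubmodule (Algebra.adjoin ℝ (Set.range (weight M))))
      (fun l => Algebra.subset_adjoin ⟨l, rfl⟩)))

theorem ofSym_ι (l : B →₀ ℝ) : ofSym M (SymmetricAlgebra.ι ℝ _ l) = weight M l := by
  simp [ofSym]
  rfl

instance : Module (SymR B) (NilHecke M) := Module.compHom _ (ofSym M).toRingHom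

theorem smul_def (f : SymR B) (h : NilHecke M) : f • h = ofSym M f * h := rfl

instance : IsScalarTower (SymR B) (NilHecke M) (NilHecke M) where
  smul_assoc f g h := mul_assoc (ofSym M f) g h

/-- The simple reflection `s = 1 - αₛ ∂ₛ` in `nh`. -/
def reflElt (s : B) : NilHecke M := 1 - weight M (simpleRoot s) * del M s

end NilHecke

end NilHecke

end Coxeter

section Functor

variable {R' P H : Type u} [CommRing R'] [AddCommGroup P] [Module R' P] [Ring H]

/-- `h ↦ ρ h ⊗ id` on `P ⊗[R'] N`. -/
def tensorRep (ρ : H →+* Module.End R' P) (N : Type u) [AddCommGroup N] [Module R' N] :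
    H →+* Module.End R' (P ⊗[R'] N) :=
  (Module.End.rTensorAlgHom R' P N).toRingHom.comp ρ

/-- The functor `N ↦ P ⊗[R'] N`, with `H` acting by `h • (p ⊗ n) = ρ h p ⊗ n`. -/
def repTensor (ρ : H →+* Module.End R' P) : ModuleCat.{u} R' ⥤ ModuleCat.{u} H where
  obj N :=
    letI := Module.compHom (P ⊗[R'] N) (tensorRep ρ N)
    ModuleCat.of H (P ⊗[R'] N)
  map {N N'} f :=
    letI := Module.compHom (P ⊗[R'] N) (tensorRep ρ N)
    letI := Module.compHom (P ⊗[R'] N') (tensorRep ρ N')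
    ModuleCat.ofHom (X := P ⊗[R'] N) (Y := P ⊗[R'] N')
      { toFun := f.hom.lTensor P
        map_add' := map_add _
        map_smul' := fun h z => by
          change (f.hom.lTensor P ∘ₗ (ρ h).rTensor N) z = ((ρ h).rTensor N' ∘ₗ f.hom.lTensor P) z
          rw [LinearMap.lTensor_comp_rTensor, LinearMap.rTensor_comp_lTensor] }
  map_id N := by
    refine ConcreteCategory.hom_ext _ _ fun z => ?_
    exact LinearMap.congr_fun (LinearMap.lTensor_id P N) z
  map_comp {N N' N''} f g := by
    refine ConcreteCategory.hom_ext _ _ fun z => ?_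
    exact LinearMap.congr_fun (LinearMap.lTensor_comp P g.hom f.hom) z

/-- The functor `N ↦ P ⊗[R'] N` with values in the monoidal category of the bialgebroid. -/
def Bialgebroid.repTensor {R : Type u} [CommRing R] [Module R H] [IsScalarTower R H H]
    (bd : Bialgebroid R H) (ρ : H →+* Module.End R' P) : ModuleCat.{u} R' ⥤ bd.Mod :=
  _root_.repTensor ρ

end Functor

end

/-! The representation ρ identifies nh with the full endomorphism ring of R over R^W, and R is a
progenerator over R^W; the bialgebroid structure and the equivalence are then formal. Freeness of R
over R^W is not needed.

The Demazure operators satisfy the braid relations because the difference of the two sides commutes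
with weights up to a twist and kills 1 (`altProd_demazure`). Positivity of roots gives Matsumoto's
theorem; with ∂ₛ² = 0 it follows that the product of the ∂ₛ along a non-reduced word vanishes. Let d
be the product along a reduced word of an element w₀ of maximal length. Then ∂ₛ d = 0 for all s, so
ρ(d) has values in R^W, and h(fd) = ρ(h)(f)d for f in R.

Over the fraction field, ρ(d) is a combination of the elements of W, and its invariance determines
all coefficients from the one at w₀. This yields a product P of ℓ(w₀) weights with ρ(d)(P) = r, a
non-zero real number. Moving P to the left in nh gives dP = r + g, where each term of g has as many
weights as factors ∂ₛ, and at least one of each. As words in the ∂ₛ longer than ℓ(w₀) vanish, the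
two-sided ideal of d contains 1 (`NilHecke.one_mem_of_add_mem`). Writing 1 = Σ kᵢ yᵢ d zᵢ gives h =
Σ ρ(h)(aᵢ) cᵢ for all h, with aᵢ = ρ(kᵢ yᵢ)(1) and cᵢ = d zᵢ (`exists_dualBasis`).

This expansion makes ρ injective, and its case h = 1 says that the aᵢ and cᵢ are a dual basis of R
over R^W, whence surjectivity. The pairings x ⊗ y ↦ ρ(x)(f) ρ(y)(g) separate the elements of nh ⊗
nh, and Δ is defined as the dual of the multiplication of R: its axioms become those of a
commutative ring, and the formula for Δ(∂ₛ) becomes the twisted Leibniz rule. Finally e = r⁻¹ dP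
gives a retraction of R onto R^W; together with the dual basis this yields the Morita equivalence,
with inverse V ↦ {x | e x = x}. -/

/-! ### Chebyshev coefficients for dihedral groups -/

/-- The coefficients `sin (k θ) / sin θ` as a function of `x = 2 cos θ`. -/
noncomputable def dihedralCoeff (x : ℝ) : ℕ → ℝ
  | 0 => 0
  | 1 => 1
  | n + 2 => x * dihedralCoeff x (n + 1) - dihedralCoeff x n

theorem dihedralCoeff_mul_sin (θ : ℝ) (k : ℕ) :
    dihedralCoeff (2 * Real.cos θ) k * Real.sin θ = Real.sin (k * θ) := by
  induction k using Nat.twoStepInduction with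
  | zero => simp [dihedralCoeff]
  | one => simp [dihedralCoeff]
  | more n h1 h2 =>
    have e1 : ((n + 2 : ℕ) : ℝ) * θ = ((n + 1 : ℕ) : ℝ) * θ + θ := by push_cast; ring
    have e2 : (n : ℝ) * θ = ((n + 1 : ℕ) : ℝ) * θ - θ := by push_cast; ring
    rw [dihedralCoeff, sub_mul, mul_assoc, h1, h2, e1, e2, Real.sin_add, Real.sin_sub]
    ring

theorem dihedralCoeff_two (k : ℕ) : dihedralCoeff 2 k = k := by
  induction k using Nat.twoStepInduction with
  | zero => simp [dihedralCoeff]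
  | one => simp [dihedralCoeff]
  | more n h1 h2 =>
    rw [dihedralCoeff, h1, h2]
    push_cast
    ring

theorem sin_pi_div_pos {m : ℕ} (hm : 2 ≤ m) : 0 < Real.sin (Real.pi / m) := by
  have hm' : (2 : ℝ) ≤ m := by exact_mod_cast hm
  refine Real.sin_pos_of_pos_of_lt_pi (by positivity) ?_
  rw [div_lt_iff₀ (by linarith)]
  nlinarith [Real.pi_pos]

/-- For k ≤ m the angle kπ/m lies in [0, π], where the sine is non-negative. -/
theorem dihedralCoeff_nonneg {m k : ℕ} (hm1 : m ≠ 1) (hk : m = 0 ∨ k ≤ m) :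
    0 ≤ dihedralCoeff (2 * Real.cos (Real.pi / m)) k := by
  rcases Nat.eq_zero_or_pos m with rfl | hm
  -- The value `m = 0` stands for infinite order; since π / 0 = 0, the parameter is 2 and the
  -- coefficient is `k`.
  · simp [dihedralCoeff_two]
  have hm2 : 2 ≤ m := by omega
  have hk' : (k : ℝ) ≤ m := by exact_mod_cast (by omega : k ≤ m)
  have hmpos : (0 : ℝ) < m := by exact_mod_cast hm
  refine nonneg_of_mul_nonneg_left ?_ (sin_pi_div_pos hm2)
  rw [dihedralCoeff_mul_sin]
  refine Real.sin_nonneg_of_nonneg_of_le_pi (by positivity) ?_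
  rw [← mul_div_assoc, div_le_iff₀ hmpos]
  nlinarith [Real.pi_pos]

theorem dihedralCoeff_self {m : ℕ} (hm : 2 ≤ m) :
    dihedralCoeff (2 * Real.cos (Real.pi / m)) m = 0 := by
  refine (mul_eq_zero.mp ?_).resolve_right (sin_pi_div_pos hm).ne'
  have : (m : ℝ) ≠ 0 := by positivity
  rw [dihedralCoeff_mul_sin, mul_div_cancel₀ _ this, Real.sin_pi]

theorem dihedralCoeff_pred {m : ℕ} (hm : 2 ≤ m) :
    dihedralCoeff (2 * Real.cos (Real.pi / m)) (m - 1) = 1 := by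
  have : (m : ℝ) ≠ 0 := by positivity
  refine mul_right_cancel₀ (sin_pi_div_pos hm).ne' ?_
  rw [dihedralCoeff_mul_sin, one_mul, Nat.cast_sub (by omega), sub_mul, mul_div_cancel₀ _ this,
    Nat.cast_one, one_mul, Real.sin_pi_sub]

/-! ### Positivity of roots -/

section Positivity

variable {B : Type u} {M : CoxeterMatrix B} {W : Type v} [Group W] (cs : CoxeterSystem M W)

open CoxeterSystem

theorem simpleReflection_simpleRoot (s t : B) :
    simpleReflection M s (simpleRoot t) =
      simpleRoot t + (2 * Real.cos (Real.pi / M s t)) • simpleRoot s := by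
  simp [simpleReflection, Module.preReflection_apply, coroot_simpleRoot, sub_eq_add_neg]

theorem simpleReflection_simpleRoot_self (s : B) :
    simpleReflection M s (simpleRoot s) = -simpleRoot s := by
  rw [simpleReflection_simpleRoot, M.diagonal]
  simp only [Nat.cast_one, div_one, Real.cos_pi]
  module

theorem geomRep_simple_simpleRoot (s t : B) :
    geomRep cs (cs.simple s) (simpleRoot t) =
      simpleRoot t + (2 * Real.cos (Real.pi / M s t)) • simpleRoot s := by
  rw [geomRep_simple, simpleReflection_simpleRoot]

theorem geomRep_simple_simpleRoot_self (s : B) :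
    geomRep cs (cs.simple s) (simpleRoot s) = -simpleRoot s := by
  rw [geomRep_simple, simpleReflection_simpleRoot_self]

/-- The plane of αₛ and αₜ is stable under both reflections, and applying the next letter is the
recursion of `dihedralCoeff`. -/
theorem geomRep_alternatingWord (s t : B) (k : ℕ) :
    geomRep cs (cs.wordProd (alternatingWord s t k)) (simpleRoot s) =
      dihedralCoeff (2 * Real.cos (Real.pi / M s t)) (k + 1) •
          simpleRoot (if Even k then s else t) +
        dihedralCoeff (2 * Real.cos (Real.pi / M s t)) k •
          simpleRoot (if Even k then t else s) := by
  induction k with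
  | zero => simp [alternatingWord, dihedralCoeff]
  | succ k ih =>
    rw [alternatingWord_succ', wordProd_cons, map_mul, Module.End.mul_apply, ih]
    by_cases hk : Even k
    · have hk' : ¬ Even (k + 1) := by simp [hk, parity_simps]
      simp only [hk, hk', if_true, if_false, map_add, map_smul, geomRep_simple_simpleRoot,
        M.diagonal, Nat.cast_one, div_one, Real.cos_pi, M.symmetric t s, dihedralCoeff]
      module
    · have hk' : Even (k + 1) := by simp [hk, parity_simps]
      simp only [hk, hk', if_true, if_false, map_add, map_smul, geomRep_simple_simpleRoot,
        M.diagonal, Nat.cast_one, div_one, Real.cos_pi, dihedralCoeff]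
      module

/-- An element with right descent `t` is `v` times an alternating word in `s` and `t` that ends
with `t`, with lengths adding up, where neither `s` nor `t` is a right descent of `v`. -/
theorem exists_eq_mul_alternatingWord {w : W} {s t : B} (ht : cs.IsRightDescent w t) :
    ∃ v k, w = v * cs.wordProd (alternatingWord s t k) ∧ cs.length w = cs.length v + k ∧
      1 ≤ k ∧ ¬ cs.IsRightDescent v s ∧ ¬ cs.IsRightDescent v t := by
  have key : ∀ (n : ℕ) (v : W) (j : ℕ), cs.length v = n →
      w = v * cs.wordProd (alternatingWord s t (j + 1)) → cs.length w = cs.length v + (j + 1) →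
      ∃ v k, w = v * cs.wordProd (alternatingWord s t k) ∧ cs.length w = cs.length v + k ∧
        1 ≤ k ∧ ¬ cs.IsRightDescent v s ∧ ¬ cs.IsRightDescent v t := by
    intro n
    induction n with
    | zero =>
      intro v j hv hw hl
      rw [cs.length_eq_zero_iff] at hv
      subst hv
      exact ⟨1, j + 1, hw, hl, by omega, cs.not_isRightDescent_one s, cs.not_isRightDescent_one t⟩
    | succ n ih =>
      intro v j hv hw hl
      -- If the first letter of the alternating word were a right descent of `v`, absorbing it into
      -- `v` would make `w` too short.
      have hy : ¬ cs.IsRightDescent v (if Even j then t else s) := by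
        rw [isRightDescent_iff]
        intro h
        rw [alternatingWord_succ', wordProd_cons, ← mul_assoc] at hw
        have h1 := cs.length_mul_le (v * cs.simple (if Even j then t else s))
          (cs.wordProd (alternatingWord s t j))
        have h2 := cs.length_wordProd_le (alternatingWord s t j)
        rw [length_alternatingWord] at h2
        rw [← hw] at h1
        omega
      by_cases hx : cs.IsRightDescent v (if Even (j + 1) then t else s)
      · rw [isRightDescent_iff] at hx
        refine ih (v * cs.simple (if Even (j + 1) then t else s)) (j + 1) (by omega) ?_ (by omega)
        rw [alternatingWord_succ', wordProd_cons, hw, mul_assoc, simple_mul_simple_cancel_left]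
      · refine ⟨v, j + 1, hw, hl, by omega, ?_⟩
        by_cases hj : Even j
        · have hj' : ¬ Even (j + 1) := by simp [hj, parity_simps]
          simp only [hj, hj', if_true, if_false] at hx hy
          exact ⟨hx, hy⟩
        · have hj' : Even (j + 1) := by simp [hj, parity_simps]
          simp only [hj, hj', if_true, if_false] at hx hy
          exact ⟨hy, hx⟩
  rw [isRightDescent_iff] at ht
  exact key _ (w * cs.simple t) 0 rfl (by simp [alternatingWord]) (by omega)

theorem exists_eq_mul_alternatingWord_of_le {w v : W} {s t : B} {m k : ℕ} (hmk : m ≤ k)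
    (hw : w = v * cs.wordProd (alternatingWord s t k)) (hl : cs.length v + k ≤ cs.length w) :
    ∃ v', w = v' * cs.wordProd (alternatingWord s t m) ∧ cs.length v' + m ≤ cs.length w := by
  induction hmk generalizing v with
  | refl => exact ⟨v, hw, hl⟩
  | @step k hk ih =>
    rw [alternatingWord_succ', wordProd_cons, ← mul_assoc] at hw
    refine ih hw ?_
    have := cs.length_mul_le v (cs.simple (if Even k then t else s))
    rw [length_simple] at this
    omega

/-- The dichotomy for the dihedral subgroup of `s` and `t` at an element with right descent `t`. -/
theorem exists_braidWord_or_geomRep_eq {w : W} {s t : B} (hst : s ≠ t)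
    (ht : cs.IsRightDescent w t) :
    (∃ v, M s t ≠ 0 ∧ w = v * cs.wordProd (braidWord M s t) ∧
      cs.length v + M s t ≤ cs.length w) ∨
    (∃ (v : W) (p q : ℝ), cs.length v < cs.length w ∧ ¬ cs.IsRightDescent v s ∧
      ¬ cs.IsRightDescent v t ∧ 0 ≤ p ∧ 0 ≤ q ∧ geomRep cs w (simpleRoot s) =
        p • geomRep cs v (simpleRoot s) + q • geomRep cs v (simpleRoot t)) := by
  obtain ⟨v, k, hw, hl, hk, hvs, hvt⟩ := exists_eq_mul_alternatingWord cs (s := s) ht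
  have hm1 := M.off_diagonal s t hst
  by_cases hm : M s t ≠ 0 ∧ M s t ≤ k
  · obtain ⟨v', h1, h2⟩ := exists_eq_mul_alternatingWord_of_le cs hm.2 hw hl.ge
    exact Or.inl ⟨v', hm.1, h1, h2⟩
  right
  -- The coefficients have indices `k` and `k + 1`, so non-negativity needs `k` strictly below a
  -- finite order.
  have hm' : M s t = 0 ∨ k + 1 ≤ M s t := by omega
  have c1 := dihedralCoeff_nonneg hm1 hm'
  have c2 : 0 ≤ dihedralCoeff (2 * Real.cos (Real.pi / M s t)) k :=
    dihedralCoeff_nonneg hm1 (by omega)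
  have key := congrArg (geomRep cs v) (geomRep_alternatingWord cs s t k)
  rw [← Module.End.mul_apply, ← map_mul, ← hw, map_add, map_smul, map_smul] at key
  by_cases hke : Even k
  · simp only [hke, if_true] at key
    exact ⟨v, _, _, by omega, hvs, hvt, c1, c2, key⟩
  · simp only [hke, if_false] at key
    exact ⟨v, _, _, by omega, hvs, hvt, c2, c1, by rw [key, add_comm]⟩

/-- By the braid relation the final braid word can be replaced by the one that ends with `s`. -/
theorem isRightDescent_of_eq_mul_braidWord {w v : W} {s t : B} (hm : M s t ≠ 0)
    (hw : w = v * cs.wordProd (braidWord M s t)) (hl : cs.length v + M s t ≤ cs.length w) :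
    cs.IsRightDescent w s := by
  obtain ⟨m, hm'⟩ := Nat.exists_eq_succ_of_ne_zero hm
  rw [wordProd_braidWord_eq, braidWord, M.symmetric, hm', alternatingWord_succ, wordProd_concat,
    ← mul_assoc] at hw
  rw [IsRightDescent, hw, simple_mul_simple_cancel_right, ← hw]
  have h1 := cs.length_mul_le v (cs.wordProd (alternatingWord s t m))
  have h2 := cs.length_wordProd_le (alternatingWord s t m)
  rw [length_alternatingWord] at h2
  omega

/-- If `ℓ (w s) > ℓ w` then `w αₛ` is a non-negative combination of simple roots. -/
theorem geomRep_simpleRoot_nonneg {w : W} {s : B} (hs : ¬ cs.IsRightDescent w s) (i : B) :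
    0 ≤ geomRep cs w (simpleRoot s) i := by
  induction hn : cs.length w using Nat.strong_induction_on generalizing w s with
  | _ n ih =>
  rcases eq_or_ne w 1 with rfl | hw
  · classical
    simp only [map_one, Module.End.one_apply, simpleRoot, Finsupp.single_apply]
    split_ifs <;> norm_num
  obtain ⟨t, ht⟩ := cs.exists_rightDescent_of_ne_one hw
  have hst : s ≠ t := by rintro rfl; exact hs ht
  -- A final braid word would produce the excluded descent `s`; otherwise induction applies to the
  -- shorter `v`.
  rcases exists_braidWord_or_geomRep_eq cs hst ht with
    ⟨v, hm, h1, h2⟩ | ⟨v, p, q, hl, hvs, hvt, hp, hq, h⟩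
  · exact absurd (isRightDescent_of_eq_mul_braidWord cs hm h1 h2) hs
  · rw [h, Finsupp.add_apply, Finsupp.smul_apply, Finsupp.smul_apply]
    have i1 := ih _ (hn ▸ hl) hvs rfl
    have i2 := ih _ (hn ▸ hl) hvt rfl
    exact add_nonneg (mul_nonneg hp i1) (mul_nonneg hq i2)

theorem geomRep_simpleRoot_nonpos {w : W} {s : B} (hs : cs.IsRightDescent w s) (i : B) :
    geomRep cs w (simpleRoot s) i ≤ 0 := by
  rw [isRightDescent_iff_not_isRightDescent_mul] at hs
  have := geomRep_simpleRoot_nonneg cs hs i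
  rw [map_mul, Module.End.mul_apply, geomRep_simple_simpleRoot_self, map_neg,
    Finsupp.neg_apply] at this
  linarith

theorem simpleRoot_ne_zero (s : B) : simpleRoot s ≠ 0 :=
  Finsupp.single_ne_zero.mpr one_ne_zero

theorem geomRep_simpleRoot_ne_zero (w : W) (s : B) : geomRep cs w (simpleRoot s) ≠ 0 := by
  intro h
  have := congrArg (geomRep cs w⁻¹) h
  rw [← Module.End.mul_apply, ← map_mul, inv_mul_cancel, map_one, map_zero] at this
  exact simpleRoot_ne_zero s this

theorem not_isRightDescent_of_nonneg {w : W} {s : B}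
    (h : ∀ i, 0 ≤ geomRep cs w (simpleRoot s) i) : ¬ cs.IsRightDescent w s := fun hs =>
  geomRep_simpleRoot_ne_zero cs w s <| Finsupp.ext fun i =>
    le_antisymm (geomRep_simpleRoot_nonpos cs hs i) (h i)

/-- A non-trivial w has a right descent s; then wαₛ has non-positive coordinates and cannot be αₛ.
-/
theorem geomRep_injective : Function.Injective (geomRep cs) := by
  refine (injective_iff_map_eq_one _).mpr fun w hw => ?_
  by_contra hne
  obtain ⟨s, hs⟩ := cs.exists_rightDescent_of_ne_one hne
  refine not_isRightDescent_of_nonneg cs (fun i => ?_) hs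
  have := geomRep_simpleRoot_nonneg cs (cs.not_isRightDescent_one s) i
  rwa [map_one, ← hw] at this

/-- An element with right descents `s ≠ t` ends with the braid word of `s` and `t`. -/
theorem exists_eq_mul_braidWord {w : W} {s t : B} (hst : s ≠ t) (hs : cs.IsRightDescent w s)
    (ht : cs.IsRightDescent w t) :
    ∃ v, M s t ≠ 0 ∧ w = v * cs.wordProd (braidWord M s t) ∧
      cs.length v + M s t ≤ cs.length w := by
  rcases exists_braidWord_or_geomRep_eq cs hst ht with h | ⟨v, p, q, hl, hvs, hvt, hp, hq, h⟩
  · exact h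
  refine absurd hs (not_isRightDescent_of_nonneg cs fun i => ?_)
  rw [h, Finsupp.add_apply, Finsupp.smul_apply, Finsupp.smul_apply]
  exact add_nonneg (mul_nonneg hp (geomRep_simpleRoot_nonneg cs hvs i))
    (mul_nonneg hq (geomRep_simpleRoot_nonneg cs hvt i))

end Positivity

/-! ### Matsumoto's theorem and non-reduced words -/

section Matsumoto

variable {B : Type u} {M : CoxeterMatrix B} {W : Type v} [Group W] (cs : CoxeterSystem M W)

open CoxeterSystem

theorem isReduced_of_concat {ω : List B} {s : B} (h : cs.IsReduced (ω.concat s)) :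
    cs.IsReduced ω := by
  have := h.take ω.length
  rwa [List.concat_eq_append, List.take_left] at this

theorem isRightDescent_of_isReduced_concat {ω : List B} {s : B} (h : cs.IsReduced (ω.concat s)) :
    cs.IsRightDescent (cs.wordProd (ω.concat s)) s := by
  rw [IsRightDescent, h.eq, wordProd_concat, simple_mul_simple_cancel_right, List.length_concat]
  exact Nat.lt_succ_of_le (cs.length_wordProd_le ω)

/-- Matsumoto's theorem: the product of a reduced word in elements that satisfy the braid relations
depends only on the product of the word in the Coxeter group. -/
theorem prod_map_eq_of_isReduced {A : Type*} [Monoid A] {f : B → A}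
    (hf : ∀ s t, M s t ≠ 0 →
      ((braidWord M s t).map f).prod = ((braidWord M t s).map f).prod)
    {ω ω' : List B} (hω : cs.IsReduced ω) (hω' : cs.IsReduced ω')
    (h : cs.wordProd ω = cs.wordProd ω') : (ω.map f).prod = (ω'.map f).prod := by
  have hlen : ω.length = ω'.length := by rw [← hω.eq, ← hω'.eq, h]
  induction hn : ω.length using Nat.strong_induction_on generalizing ω ω' with
  | _ n ih =>
  -- words with the same last letter
  have same : ∀ {α β : List B} {s : B}, cs.IsReduced (α.concat s) → cs.IsReduced (β.concat s) →
      cs.wordProd (α.concat s) = cs.wordProd (β.concat s) → (α.concat s).length = n →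
      ((α.concat s).map f).prod = ((β.concat s).map f).prod := by
    intro α β s hα hβ hαβ hl
    have hα' := isReduced_of_concat cs hα
    have hβ' := isReduced_of_concat cs hβ
    rw [wordProd_concat, wordProd_concat, mul_left_inj] at hαβ
    rw [List.length_concat] at hl
    have := ih α.length (by omega) hα' hβ' hαβ (by rw [← hα'.eq, ← hβ'.eq, hαβ]) rfl
    simp only [List.concat_eq_append, List.map_append, List.prod_append, this]
  rcases List.eq_nil_or_concat ω with rfl | ⟨α, s, rfl⟩
  · rw [List.length_nil, eq_comm, List.length_eq_zero_iff] at hlen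
    rw [hlen]
  rcases List.eq_nil_or_concat ω' with rfl | ⟨β, t, rfl⟩
  · simp at hlen
  rcases eq_or_ne s t with rfl | hst
  · exact same hω hω' h hn
  have hs := isRightDescent_of_isReduced_concat cs hω
  have ht := isRightDescent_of_isReduced_concat cs hω'
  rw [← h] at ht
  -- For different last letters, the element ends with the braid word of `s` and `t`. Its two forms
  -- share their last letters with the two given words, which reduces to the case of equal last
  -- letters and one braid relation.
  obtain ⟨v, hm, hv, hl⟩ := exists_eq_mul_braidWord cs hst hs ht
  obtain ⟨γ, hγ, rfl⟩ := cs.exists_isReduced v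
  have hv' := hv
  rw [wordProd_braidWord_eq] at hv'
  rw [← wordProd_append] at hv hv'
  have r1 : cs.IsReduced (γ ++ braidWord M s t) := by
    refine le_antisymm (cs.length_wordProd_le _) ?_
    rw [← hv, List.length_append, length_alternatingWord, ← hγ.eq]
    exact hl
  have r2 : cs.IsReduced (γ ++ braidWord M t s) := by
    refine le_antisymm (cs.length_wordProd_le _) ?_
    rw [← hv', List.length_append, length_alternatingWord, ← hγ.eq, M.symmetric t s]
    exact hl
  obtain ⟨m, hm'⟩ := Nat.exists_eq_succ_of_ne_zero hm
  have e1 : γ ++ braidWord M s t = (γ ++ alternatingWord t s m).concat t := by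
    rw [braidWord, hm', alternatingWord_succ]; simp
  have e2 : γ ++ braidWord M t s = (γ ++ alternatingWord s t m).concat s := by
    rw [braidWord, M.symmetric, hm', alternatingWord_succ]; simp
  have p1 : ((α.concat s).map f).prod = ((γ ++ braidWord M t s).map f).prod := by
    rw [e2] at r2 hv' ⊢
    exact same hω r2 hv' hn
  have p2 : ((β.concat t).map f).prod = ((γ ++ braidWord M s t).map f).prod := by
    rw [e1] at r1 hv ⊢
    exact same hω' r1 (h.symm.trans hv) (hlen.symm.trans hn)
  rw [p1, p2, List.map_append, List.map_append, List.prod_append, List.prod_append, hf s t hm]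

/-- If moreover the elements square to zero, then the product of a word that is not reduced is
zero. -/
theorem prod_map_eq_zero_of_not_isReduced {A : Type*} [MonoidWithZero A] {f : B → A}
    (hf : ∀ s t, M s t ≠ 0 →
      ((braidWord M s t).map f).prod = ((braidWord M t s).map f).prod)
    (hsq : ∀ s, f s * f s = 0) {ω : List B} (hω : ¬ cs.IsReduced ω) :
    (ω.map f).prod = 0 := by
  induction ω using List.reverseRecOn with
  | nil => exact absurd (by simp [CoxeterSystem.IsReduced]) hω
  | append_singleton ω s ih =>
    rw [List.map_append, List.prod_append]
    by_cases h : cs.IsReduced ω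
    -- Here `s` is a descent of the reduced word `ω`, so Matsumoto's theorem allows `ω` to be
    -- replaced by a reduced word ending in `s`, and a square `f s * f s` appears.
    · have hs : cs.IsRightDescent (cs.wordProd ω) s := by
        by_contra hs
        rw [not_isRightDescent_iff, h.eq] at hs
        refine hω ?_
        rw [CoxeterSystem.IsReduced, wordProd_append, wordProd_singleton, hs]
        simp
      obtain ⟨γ, hγ, hγ'⟩ := cs.exists_isReduced (cs.wordProd ω * cs.simple s)
      have hprod : cs.wordProd ω = cs.wordProd (γ ++ [s]) := by
        rw [wordProd_append, ← hγ', wordProd_singleton, simple_mul_simple_cancel_right]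
      have hred : cs.IsReduced (γ ++ [s]) := by
        rw [isRightDescent_iff, hγ', hγ.eq] at hs
        rw [CoxeterSystem.IsReduced, ← hprod, ← hs]
        simp
      rw [prod_map_eq_of_isReduced cs hf h hred hprod]
      simp [mul_assoc, hsq]
    · rw [ih h, zero_mul]

end Matsumoto

/-- The module embeds in its square-zero extension, which is a commutative algebra, and this
embedding factors through the symmetric algebra. -/
theorem SymmetricAlgebra.ι_injective {S V : Type*} [CommRing S] [AddCommGroup V] [Module S V] :
    Function.Injective (SymmetricAlgebra.ι S V) := by
  let _ : Module Sᵐᵒᵖ V := Module.compHom V ((RingHom.id S).fromOpposite mul_comm)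
  have : IsCentralScalar S V := ⟨fun _ _ => rfl⟩
  intro x y h
  have := congrArg (SymmetricAlgebra.lift (TrivSqZeroExt.inrHom S V)) h
  simpa only [SymmetricAlgebra.lift_ι_apply, TrivSqZeroExt.inrHom_apply,
    TrivSqZeroExt.inr_injective.eq_iff] using this

section Braid

variable {A : Type*} [Monoid A]

theorem altProd_succ_right (a b : A) (n : ℕ) :
    altProd a b (n + 1) = altProd a b n * (if Even n then a else b) := by
  induction n generalizing a b with
  | zero => simp [altProd]
  | succ n ih =>
    rw [altProd, ih b a, ← mul_assoc]
    by_cases hn : Even n <;> simp [hn, altProd, parity_simps, -Nat.not_even_iff_odd]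

/-- `alternatingWord` is anchored at its last letter and `altProd` at its first, hence the
dependence on parity. -/
theorem prod_map_alternatingWord {B : Type*} (f : B → A) (s t : B) (m : ℕ) :
    ((CoxeterSystem.alternatingWord s t m).map f).prod =
      if Even m then altProd (f s) (f t) m else altProd (f t) (f s) m := by
  induction m with
  | zero => simp [CoxeterSystem.alternatingWord, altProd]
  | succ m ih =>
    rw [CoxeterSystem.alternatingWord_succ', List.map_cons, List.prod_cons, ih]
    by_cases hm : Even m <;> simp [hm, altProd, parity_simps, -Nat.not_even_iff_odd]

theorem prod_map_braidWord_eq_iff {B : Type*} (M : CoxeterMatrix B) (f : B → A) (s t : B) :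
    ((CoxeterSystem.braidWord M s t).map f).prod = ((CoxeterSystem.braidWord M t s).map f).prod ↔
      altProd (f s) (f t) (M s t) = altProd (f t) (f s) (M s t) := by
  rw [prod_map_alternatingWord, prod_map_alternatingWord, M.symmetric t s]
  split_ifs
  · rfl
  · exact eq_comm

theorem map_altProd {A' F : Type*} [Monoid A'] [FunLike F A A'] [MonoidHomClass F A A'] (φ : F)
    (a b : A) (n : ℕ) : φ (altProd a b n) = altProd (φ a) (φ b) n := by
  induction n generalizing a b with
  | zero => simp [altProd]
  | succ n ih => simp [altProd, ih]

end Braid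

/-! ### Commuting weights past alternating products -/

section WeightCommutation

variable {S A V : Type*} [CommRing S] [Ring A] [Algebra S A] [AddCommGroup V] [Module S V]

/-- Moving a weight through an alternating product of at least two square-zero elements: only the
deletions of the first and of the last factor survive. -/
theorem altProd_mul_weight (L : V → A) {x y : A} {σ τ : Module.End S V} {a b : V → S}
    (hx : x * x = 0) (hy : y * y = 0)
    (hxL : ∀ l, x * L l = L (σ l) * x + algebraMap S A (a l))
    (hyL : ∀ l, y * L l = L (τ l) * y + algebraMap S A (b l)) (n : ℕ) (l : V) :
    altProd x y (n + 2) * L l = L (altProd σ τ (n + 2) l) * altProd x y (n + 2) +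
      algebraMap S A (a (altProd τ σ (n + 1) l)) * altProd y x (n + 1) +
      algebraMap S A (if Even n then b l else a l) * altProd x y (n + 1) := by
  induction n generalizing x y σ τ a b with
  | zero =>
    simp only [altProd, mul_one, mul_assoc, hyL, mul_add, Even.zero, if_true, Module.End.mul_apply]
    rw [← mul_assoc, hxL, add_mul, Algebra.commutes (b l) x, mul_assoc]
  | succ n ih =>
    -- Deleting the first factor of the shorter product leaves one that begins with `x`, and
    -- multiplying by `x` again gives zero.
    have hz : ∀ c : S, x * (algebraMap S A c * altProd x y (n + 1)) = 0 := fun c => by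
      rw [← mul_assoc, ← Algebra.commutes, mul_assoc, altProd, ← mul_assoc x, hx, zero_mul,
        mul_zero]
    have hc : ∀ c : S, x * (algebraMap S A c * altProd y x (n + 1)) =
        algebraMap S A c * altProd x y (n + 2) := fun c => by
      rw [← mul_assoc, ← Algebra.commutes, mul_assoc]; rfl
    have hp : (if Even (n + 1) then b l else a l) = if Even n then a l else b l := by
      by_cases hn : Even n <;> simp [hn, parity_simps, -Nat.not_even_iff_odd]
    calc altProd x y (n + 3) * L l = x * (altProd y x (n + 2) * L l) := by
          rw [← mul_assoc]; rfl
      _ = x * L (altProd τ σ (n + 2) l) * altProd y x (n + 2) +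
            algebraMap S A (if Even n then a l else b l) * altProd x y (n + 2) := by
          rw [ih hy hx hyL hxL, mul_add, mul_add, hz, hc, add_zero, mul_assoc]
      _ = _ := by
          rw [hxL, add_mul, mul_assoc, hp]; rfl

end WeightCommutation

section DihedralCoroot

variable {B : Type u} (M : CoxeterMatrix B)

theorem coroot_simpleReflection (s t : B) (l : B →₀ ℝ) :
    coroot M s (simpleReflection M t l) =
      coroot M s l + 2 * Real.cos (Real.pi / M s t) * coroot M t l := by
  simp only [simpleReflection, Module.preReflection_apply, map_sub, map_smul, coroot_simpleRoot,
    smul_eq_mul]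
  ring

theorem coroot_altProd (s t : B) (k : ℕ) (l : B →₀ ℝ) :
    coroot M s (altProd (simpleReflection M t) (simpleReflection M s) k l) =
      dihedralCoeff (2 * Real.cos (Real.pi / M s t)) (k + 1) *
          coroot M (if Even k then s else t) l +
        dihedralCoeff (2 * Real.cos (Real.pi / M s t)) k *
          coroot M (if Even k then t else s) l := by
  induction k generalizing l with
  | zero => simp [altProd, dihedralCoeff]
  | succ k ih =>
    rw [altProd_succ_right, Module.End.mul_apply, ih]
    by_cases hk : Even k
    · have hk' : ¬ Even (k + 1) := by simp [hk, parity_simps]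
      simp only [hk, hk', if_true, if_false, coroot_simpleReflection, M.diagonal, Nat.cast_one,
        div_one, Real.cos_pi, dihedralCoeff]
      ring
    · have hk' : Even (k + 1) := by simp [hk, parity_simps]
      simp only [hk, hk', if_true, if_false, coroot_simpleReflection, M.diagonal, Nat.cast_one,
        div_one, Real.cos_pi, dihedralCoeff, M.symmetric t s]
      ring

/-- At m = mₛₜ the coefficients of index m and m - 1 are 0 and 1, so an alternating product of m - 1
reflections carries one simple coroot to a simple coroot. This is what matches the lower-order terms
in the braid relation. -/
theorem coroot_altProd_pred {s t : B} {n : ℕ} (hn : M s t = n + 2) (l : B →₀ ℝ) :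
    coroot M s (altProd (simpleReflection M t) (simpleReflection M s) (n + 1) l) =
      if Even n then coroot M s l else coroot M t l := by
  have h1 := dihedralCoeff_self (m := M s t) (by omega)
  have h2 := dihedralCoeff_pred (m := M s t) (by omega)
  rw [coroot_altProd]
  rw [show M s t - 1 = n + 1 by omega] at h2
  rw [show dihedralCoeff (2 * Real.cos (Real.pi / M s t)) (n + 1 + 1) = 0 by
    rw [← h1]; congr 1; omega, h2]
  by_cases hk : Even n <;> simp [hk, parity_simps, -Nat.not_even_iff_odd]

end DihedralCoroot

/-! ### Demazure operators and the representation on R -/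

section Demazure

variable {B : Type u} {M : CoxeterMatrix B} {W : Type v} [Group W] (cs : CoxeterSystem M W)

theorem symAction_ι (w : W) (l : B →₀ ℝ) :
    symAction cs w (SymmetricAlgebra.ι ℝ _ l) = SymmetricAlgebra.ι ℝ _ (geomRep cs w l) :=
  SymmetricAlgebra.lift_ι_apply _ _

theorem symAction_simple_ι (s : B) (l : B →₀ ℝ) :
    symAction cs (cs.simple s) (SymmetricAlgebra.ι ℝ _ l) =
      SymmetricAlgebra.ι ℝ _ l -
        algebraMap ℝ _ (coroot M s l) * SymmetricAlgebra.ι ℝ _ (simpleRoot s) := by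
  rw [symAction_ι, geomRep_simple, simpleReflection, Module.preReflection_apply, map_sub, map_smul,
    Algebra.smul_def]

theorem ι_simpleRoot_ne_zero (s : B) : SymmetricAlgebra.ι ℝ (B →₀ ℝ) (simpleRoot s) ≠ 0 := by
  rw [← map_zero (SymmetricAlgebra.ι ℝ (B →₀ ℝ))]
  exact SymmetricAlgebra.ι_injective.ne (simpleRoot_ne_zero s)

/-- The f with αₛ dividing f - s(f) form a subalgebra, by fg - s(fg) = (f - s(f))g + s(f)(g - s(g)),
and it contains the weights. -/
theorem exists_ι_simpleRoot_mul_eq (s : B) (f : SymR B) :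
    ∃ g, SymmetricAlgebra.ι ℝ _ (simpleRoot s) * g = f - symAction cs (cs.simple s) f := by
  induction f using SymmetricAlgebra.induction with
  | algebraMap r => exact ⟨0, by simp⟩
  | ι l => exact ⟨algebraMap ℝ _ (coroot M s l), by rw [symAction_simple_ι]; ring⟩
  | add f g hf hg =>
    obtain ⟨f', hf⟩ := hf
    obtain ⟨g', hg⟩ := hg
    exact ⟨f' + g', by rw [mul_add, hf, hg, map_add]; ring⟩
  | mul f g hf hg =>
    obtain ⟨f', hf⟩ := hf
    obtain ⟨g', hg⟩ := hg
    refine ⟨f' * g + symAction cs (cs.simple s) f * g', ?_⟩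
    rw [map_mul]
    linear_combination g * hf + symAction cs (cs.simple s) f * hg

/-- The Demazure operator `f ↦ (f - s f) / αₛ` as a function. -/
noncomputable def demazureFun (s : B) (f : SymR B) : SymR B :=
  (exists_ι_simpleRoot_mul_eq cs s f).choose

theorem ι_mul_demazureFun (s : B) (f : SymR B) :
    SymmetricAlgebra.ι ℝ _ (simpleRoot s) * demazureFun cs s f =
      f - symAction cs (cs.simple s) f :=
  (exists_ι_simpleRoot_mul_eq cs s f).choose_spec

/-- R is a domain, so αₛ can be cancelled; the identities for Demazure operators are verified after
multiplication by αₛ. -/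
theorem eq_demazureFun {s : B} {f g : SymR B}
    (h : SymmetricAlgebra.ι ℝ _ (simpleRoot s) * g = f - symAction cs (cs.simple s) f) :
    demazureFun cs s f = g :=
  mul_left_cancel₀ (ι_simpleRoot_ne_zero s) ((ι_mul_demazureFun cs s f).trans h.symm)

/-- The Demazure operator `f ↦ (f - s f) / αₛ`. -/
noncomputable def demazure (s : B) : Module.End (invariants cs) (SymR B) where
  toFun := demazureFun cs s
  map_add' f g := eq_demazureFun cs <| by
    rw [mul_add, ι_mul_demazureFun, ι_mul_demazureFun, map_add]; ring
  map_smul' a f := eq_demazureFun cs <| by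
    have ha : symAction cs (cs.simple s) a = a := a.2 _
    simp only [Subalgebra.smul_def, smul_eq_mul, RingHom.id_apply, map_mul, ha]
    linear_combination (a : SymR B) * ι_mul_demazureFun cs s f

theorem ι_mul_demazure (s : B) (f : SymR B) :
    SymmetricAlgebra.ι ℝ _ (simpleRoot s) * demazure cs s f =
      f - symAction cs (cs.simple s) f :=
  ι_mul_demazureFun cs s f

theorem eq_demazure {s : B} {f g : SymR B}
    (h : SymmetricAlgebra.ι ℝ _ (simpleRoot s) * g = f - symAction cs (cs.simple s) f) :
    demazure cs s f = g :=
  eq_demazureFun cs h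

/-- This twisted Leibniz rule is the source of Δ(∂ₛ) = ∂ₛ ⊗ s + 1 ⊗ ∂ₛ. -/
theorem demazure_mul (s : B) (f g : SymR B) :
    demazure cs s (f * g) =
      demazure cs s f * symAction cs (cs.simple s) g + f * demazure cs s g :=
  eq_demazure cs <| by
    rw [map_mul]
    linear_combination symAction cs (cs.simple s) g * ι_mul_demazure cs s f +
      f * ι_mul_demazure cs s g

theorem demazure_one (s : B) : demazure cs s 1 = 0 :=
  eq_demazure cs (by simp)

theorem demazure_ι_mul (s : B) (l : B →₀ ℝ) (f : SymR B) :
    demazure cs s (SymmetricAlgebra.ι ℝ _ l * f) =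
      SymmetricAlgebra.ι ℝ _ (simpleReflection M s l) * demazure cs s f +
        algebraMap ℝ _ (coroot M s l) * f :=
  eq_demazure cs <| by
    have h := symAction_simple_ι cs s l
    have h' := h
    rw [symAction_ι, geomRep_simple] at h'
    rw [map_mul, h', h]
    linear_combination (SymmetricAlgebra.ι ℝ _ l - algebraMap ℝ (SymR B) (coroot M s l) *
      SymmetricAlgebra.ι ℝ _ (simpleRoot s)) * ι_mul_demazure cs s f

/-- Both αₛ and f - s(f) change sign under s. -/
theorem symAction_demazure (s : B) (f : SymR B) :
    symAction cs (cs.simple s) (demazure cs s f) = demazure cs s f := by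
  have h := congrArg (symAction cs (cs.simple s)) (ι_mul_demazure cs s f)
  rw [map_mul, map_sub, ← AlgHom.mul_apply, ← map_mul (symAction cs), cs.simple_mul_simple_self,
    map_one, AlgHom.one_apply, symAction_simple_ι, coroot_simpleRoot_self] at h
  refine mul_left_cancel₀ (ι_simpleRoot_ne_zero s) ?_
  rw [ι_mul_demazure]
  rw [show algebraMap ℝ (SymR B) 2 = 2 from map_ofNat _ 2] at h
  linear_combination -h

theorem demazure_mul_self (s : B) : demazure cs s * demazure cs s = 0 :=
  LinearMap.ext fun f => eq_demazure cs <| by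
    rw [symAction_demazure, LinearMap.zero_apply, mul_zero, sub_self]

theorem symAction_eq_of_demazure_eq_zero {s : B} {f : SymR B} (h : demazure cs s f = 0) :
    symAction cs (cs.simple s) f = f := by
  have := ι_mul_demazure cs s f
  rw [h, mul_zero, eq_comm, sub_eq_zero] at this
  exact this.symm

theorem mem_invariants_of_demazure {f : SymR B} (h : ∀ s, demazure cs s f = 0) :
    f ∈ invariants cs := by
  intro w
  induction w using cs.simple_induction_left with
  | one => simp
  | mul_simple_left w s hw =>
    rw [map_mul, AlgHom.mul_apply, hw, symAction_eq_of_demazure_eq_zero cs (h s)]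

/-- Multiplication by a weight. -/
noncomputable def weightMul (l : B →₀ ℝ) : Module.End (invariants cs) (SymR B) :=
  LinearMap.mulLeft _ (SymmetricAlgebra.ι ℝ _ l)

theorem weightMul_apply (l : B →₀ ℝ) (f : SymR B) :
    weightMul cs l f = SymmetricAlgebra.ι ℝ _ l * f := rfl

theorem algebraMap_end_invariants_apply (c : ℝ) (f : SymR B) :
    algebraMap ℝ (Module.End (invariants cs) (SymR B)) c f = algebraMap ℝ _ c * f := by
  rw [Module.algebraMap_end_apply, Algebra.smul_def]

theorem demazure_mul_weightMul (s : B) (l : B →₀ ℝ) :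
    demazure cs s * weightMul cs l =
      weightMul cs (simpleReflection M s l) * demazure cs s +
        algebraMap ℝ _ (coroot M s l) := by
  refine LinearMap.ext fun f => ?_
  rw [LinearMap.add_apply, algebraMap_end_invariants_apply]
  exact demazure_ι_mul cs s l f

theorem altProd_demazure_one (s t : B) (n : ℕ) :
    altProd (demazure cs s) (demazure cs t) (n + 1) 1 = 0 := by
  rw [altProd_succ_right, Module.End.mul_apply]
  split_ifs <;> rw [demazure_one, map_zero]

/-- An operator that commutes with weights up to a twist and kills `1` is zero. -/
theorem eq_zero_of_mul_weightMul {Z : Module.End (invariants cs) (SymR B)}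
    {σ : (B →₀ ℝ) → (B →₀ ℝ)} (h : ∀ l, Z * weightMul cs l = weightMul cs (σ l) * Z)
    (h1 : Z 1 = 0) : Z = 0 := by
  -- The twisted commutation extends from weights to all of R; then Z(f) = f' Z(1) = 0.
  have key : ∀ f : SymR B, ∃ f', ∀ g, Z (f * g) = f' * Z g := by
    intro f
    induction f using SymmetricAlgebra.induction with
    | algebraMap r =>
      refine ⟨algebraMap ℝ _ r, fun g => ?_⟩
      have := map_smul Z (algebraMap ℝ (invariants cs) r) g
      exact this
    | ι l => exact ⟨SymmetricAlgebra.ι ℝ _ (σ l), fun g => LinearMap.congr_fun (h l) g⟩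
    | add f g hf hg =>
      obtain ⟨f', hf⟩ := hf
      obtain ⟨g', hg⟩ := hg
      exact ⟨f' + g', fun k => by rw [add_mul, map_add, hf, hg, add_mul]⟩
    | mul f g hf hg =>
      obtain ⟨f', hf⟩ := hf
      obtain ⟨g', hg⟩ := hg
      exact ⟨f' * g', fun k => by rw [mul_assoc, hf, hg, mul_assoc]⟩
  refine LinearMap.ext fun f => ?_
  obtain ⟨f', hf⟩ := key f
  rw [← mul_one f, hf, h1, mul_zero, LinearMap.zero_apply]

theorem altProd_simpleReflection (cs : CoxeterSystem M W) (s t : B) :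
    altProd (simpleReflection M s) (simpleReflection M t) (M s t) =
      altProd (simpleReflection M t) (simpleReflection M s) (M s t) := by
  have h := (prod_map_braidWord_eq_iff M cs.simple s t).mp (cs.wordProd_braidWord_eq s t)
  have h2 := congrArg (geomRep cs) h
  rwa [map_altProd, map_altProd, geomRep_simple, geomRep_simple] at h2

/-- When a weight is moved through both sides, the lower-order terms agree crosswise by
`coroot_altProd_pred`. The difference therefore commutes with weights up to the common product of
reflections, and it kills 1. -/
theorem altProd_demazure (s t : B) :
    altProd (demazure cs s) (demazure cs t) (M s t) =
      altProd (demazure cs t) (demazure cs s) (M s t) := by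
  rcases eq_or_ne s t with rfl | hst
  · rfl
  have hm1 := M.off_diagonal s t hst
  have hbr := altProd_simpleReflection cs s t
  obtain hm | ⟨n, hn⟩ : M s t = 0 ∨ ∃ n, M s t = n + 2 := by
    rcases h : M s t with _ | _ | n
    · exact Or.inl rfl
    · exact absurd h hm1
    · exact Or.inr ⟨n, rfl⟩
  · rw [hm]; rfl
  have c1 := coroot_altProd_pred M hn
  have c2 := coroot_altProd_pred M ((M.symmetric t s).trans hn)
  rw [hn] at hbr ⊢
  rw [← sub_eq_zero]
  refine eq_zero_of_mul_weightMul cs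
    (σ := fun l => altProd (simpleReflection M s) (simpleReflection M t) (n + 2) l)
    (fun l => ?_) ?_
  · rw [sub_mul,
      altProd_mul_weight (weightMul cs) (demazure_mul_self cs s) (demazure_mul_self cs t)
        (demazure_mul_weightMul cs s) (demazure_mul_weightMul cs t),
      altProd_mul_weight (weightMul cs) (demazure_mul_self cs t) (demazure_mul_self cs s)
        (demazure_mul_weightMul cs t) (demazure_mul_weightMul cs s), c1, c2, ← hbr, mul_sub]
    abel
  · rw [LinearMap.sub_apply, altProd_demazure_one, altProd_demazure_one, sub_zero]

/-- The representation of the nil Hecke algebra on `R` by Demazure operators. -/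
noncomputable def nilHeckeRep : NilHecke M →ₐ[ℝ] Module.End (invariants cs) (SymR B) :=
  RingQuot.liftAlgHom (s := NilHeckeRel M) ℝ
    ⟨FreeAlgebra.lift ℝ (Sum.elim (weightMul cs) (demazure cs)), by
      intro x y h
      induction h with
      | add l m =>
        simp only [map_add, FreeAlgebra.lift_ι_apply, Sum.elim_inl]
        refine LinearMap.ext fun f => ?_
        simp only [weightMul_apply, LinearMap.add_apply, map_add, add_mul]
      | smul c l =>
        simp only [map_smul, FreeAlgebra.lift_ι_apply, Sum.elim_inl]
        refine LinearMap.ext fun f => ?_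
        simp only [weightMul_apply, LinearMap.smul_apply, map_smul, smul_mul_assoc]
      | comm l m =>
        simp only [map_mul, FreeAlgebra.lift_ι_apply, Sum.elim_inl]
        refine LinearMap.ext fun f => ?_
        simp only [weightMul_apply, Module.End.mul_apply]
        ring
      | weyl s l =>
        simp only [map_mul, map_add, FreeAlgebra.lift_ι_apply, Sum.elim_inl, Sum.elim_inr,
          AlgHom.commutes]
        exact demazure_mul_weightMul cs s l
      | sq s =>
        simp only [map_mul, map_zero, FreeAlgebra.lift_ι_apply, Sum.elim_inr]
        exact demazure_mul_self cs s
      | braid s t =>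
        simp only [map_altProd, FreeAlgebra.lift_ι_apply, Sum.elim_inr]
        exact altProd_demazure cs s t⟩

theorem nilHeckeRep_mk (x : FreeAlgebra ℝ ((B →₀ ℝ) ⊕ B)) :
    nilHeckeRep cs (NilHecke.mk M x) =
      FreeAlgebra.lift ℝ (Sum.elim (weightMul cs) (demazure cs)) x :=
  RingQuot.liftAlgHom_mkAlgHom_apply ..

theorem nilHeckeRep_weight (l : B →₀ ℝ) :
    nilHeckeRep cs (NilHecke.weight M l) = weightMul cs l := by
  rw [show NilHecke.weight M l = NilHecke.mk M (.ι ℝ (.inl l)) from rfl, nilHeckeRep_mk]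
  simp

theorem nilHeckeRep_del (s : B) : nilHeckeRep cs (NilHecke.del M s) = demazure cs s := by
  rw [NilHecke.del, nilHeckeRep_mk]
  simp

theorem nilHeckeRep_reflElt (s : B) (f : SymR B) :
    nilHeckeRep cs (NilHecke.reflElt M s) f = symAction cs (cs.simple s) f := by
  rw [NilHecke.reflElt, map_sub, map_mul, map_one, nilHeckeRep_weight, nilHeckeRep_del,
    LinearMap.sub_apply, Module.End.mul_apply, weightMul_apply, ι_mul_demazure]
  simp

theorem nilHeckeRep_ofSym (f g : SymR B) : nilHeckeRep cs (NilHecke.ofSym M f) g = f * g := by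
  induction f using SymmetricAlgebra.induction generalizing g with
  | algebraMap r => rw [AlgHom.commutes, AlgHom.commutes, algebraMap_end_invariants_apply]
  | ι l => rw [NilHecke.ofSym_ι, nilHeckeRep_weight, weightMul_apply]
  | add f f' hf hf' => rw [map_add, map_add, LinearMap.add_apply, hf, hf', add_mul]
  | mul f f' hf hf' => rw [map_mul, map_mul, Module.End.mul_apply, hf', hf, mul_assoc]

theorem nilHeckeRep_smul (f : SymR B) (h : NilHecke M) (g : SymR B) :
    nilHeckeRep cs (f • h) g = f * nilHeckeRep cs h g := by
  rw [NilHecke.smul_def, map_mul, Module.End.mul_apply, nilHeckeRep_ofSym]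

end Demazure

/-! ### Words, degrees and ideals in the nil Hecke algebra -/

section Words

variable {B : Type u} {M : CoxeterMatrix B} {W : Type v} [Group W] (cs : CoxeterSystem M W)

namespace NilHecke

variable (M)

/-- The product of the `∂ₛ` along a word. -/
noncomputable def delProd (ω : List B) : NilHecke M := (ω.map (del M)).prod

/-- The product of a list of weights. -/
noncomputable def weightProd (p : List (B →₀ ℝ)) : NilHecke M := (p.map (weight M)).prod

variable {M}

theorem delProd_nil : delProd M ([] : List B) = 1 := rfl

theorem delProd_cons (s : B) (ω : List B) : delProd M (s :: ω) = del M s * delProd M ω := by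
  simp [delProd]

theorem delProd_append (ω ω' : List B) :
    delProd M (ω ++ ω') = delProd M ω * delProd M ω' := by
  simp [delProd]

theorem weightProd_append (p p' : List (B →₀ ℝ)) :
    weightProd M (p ++ p') = weightProd M p * weightProd M p' := by
  simp [weightProd]

theorem del_mul_self (s : B) : del M s * del M s = 0 := by
  rw [del, ← map_mul, mk_rel M (.sq s), map_zero]

theorem del_mul_weight (s : B) (l : B →₀ ℝ) :
    del M s * weight M l =
      weight M (simpleReflection M s l) * del M s + algebraMap ℝ _ (coroot M s l) := by
  change mk M _ * mk M _ = mk M _ * mk M _ + _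
  rw [← map_mul, mk_rel M (.weyl s l), map_add, map_mul, AlgHom.commutes]

theorem altProd_del (s t : B) :
    altProd (del M s) (del M t) (M s t) = altProd (del M t) (del M s) (M s t) := by
  have := mk_rel M (.braid s t)
  rwa [map_altProd, map_altProd] at this

/-- The ∂ₛ satisfy the braid relations and square to zero, which is all that the argument on
non-reduced words requires. -/
theorem delProd_eq_zero (cs : CoxeterSystem M W) {ω : List B} (hω : ¬ cs.IsReduced ω) :
    delProd M ω = 0 :=
  prod_map_eq_zero_of_not_isReduced cs
    (fun s t _ => (prod_map_braidWord_eq_iff M (del M) s t).mpr (altProd_del s t))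
    del_mul_self hω

theorem delProd_eq_zero_of_lt_length (cs : CoxeterSystem M W) {n : ℕ}
    (hn : ∀ w, cs.length w ≤ n) {ω : List B} (hω : n < ω.length) : delProd M ω = 0 :=
  delProd_eq_zero cs fun h => by
    have := hn (cs.wordProd ω)
    rw [h.eq] at this
    omega

theorem ofSym_prod (p : List (B →₀ ℝ)) :
    ofSym M (p.map (SymmetricAlgebra.ι ℝ _)).prod = weightProd M p := by
  rw [map_list_prod, List.map_map, weightProd]
  congr 2
  funext l
  exact ofSym_ι M l

/-- The defining relation is the case of a weight; both sides then extend to products by the twisted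
Leibniz rule. -/
theorem del_mul_ofSym (s : B) (f : SymR B) :
    del M s * ofSym M f =
      ofSym M (symAction cs (cs.simple s) f) * del M s + ofSym M (demazure cs s f) := by
  induction f using SymmetricAlgebra.induction with
  | algebraMap r =>
    have : demazure cs s (algebraMap ℝ _ r) = 0 := eq_demazure cs (by simp)
    rw [this, AlgHom.commutes, AlgHom.commutes, map_zero, add_zero, AlgHom.commutes,
      Algebra.commutes]
  | ι l =>
    have : demazure cs s (SymmetricAlgebra.ι ℝ _ l) = algebraMap ℝ _ (coroot M s l) := by
      have := demazure_ι_mul cs s l 1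
      rwa [demazure_one, mul_zero, zero_add, mul_one, mul_one] at this
    rw [this, symAction_ι, geomRep_simple, ofSym_ι, ofSym_ι, AlgHom.commutes, del_mul_weight]
  | add f g hf hg => simp only [map_add, mul_add, add_mul, hf, hg]; abel
  | mul f g hf hg =>
    rw [map_mul, ← mul_assoc, hf, add_mul, mul_assoc, hg, mul_comm f g, demazure_mul]
    simp only [map_mul, map_add, mul_add, mul_assoc]
    simp only [← map_mul, ← mul_assoc, mul_comm, add_assoc]

theorem mk_surjective : Function.Surjective (mk M) := RingQuot.mkAlgHom_surjective ℝ _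

/-- The left ideal generated by an element killed by all `∂ₛ` is a quotient of the representation
on `R`. -/
theorem mul_smul_eq_of_del_mul_eq_zero {d : NilHecke M} (hd : ∀ s, del M s * d = 0)
    (h : NilHecke M) (f : SymR B) : h * (f • d) = nilHeckeRep cs h f • d := by
  obtain ⟨x, rfl⟩ := mk_surjective h
  induction x using FreeAlgebra.induction generalizing f with
  | grade0 r =>
    rw [AlgHom.commutes, AlgHom.commutes, algebraMap_end_invariants_apply, smul_def, smul_def,
      map_mul, AlgHom.commutes, mul_assoc]
  | grade1 x =>
    rcases x with l | s
    · change weight M l * _ = nilHeckeRep cs (weight M l) f • d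
      rw [nilHeckeRep_weight, weightMul_apply, smul_def, smul_def, map_mul, ofSym_ι, mul_assoc]
    · change del M s * _ = nilHeckeRep cs (del M s) f • d
      -- In ∂ₛ f d = s(f) ∂ₛ d + ∂ₛ(f) d the first summand vanishes.
      rw [nilHeckeRep_del, smul_def, smul_def, ← mul_assoc, del_mul_ofSym cs, add_mul, mul_assoc,
        hd, mul_zero, zero_add]
  | mul a b ha hb => rw [map_mul, map_mul, mul_assoc, hb, ha, Module.End.mul_apply]
  | add a b ha hb => rw [map_add, map_add, add_mul, ha, hb, LinearMap.add_apply, add_smul]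

/-- The span of the products of weights and `∂ₛ` of degree `j - i`, where weights have degree `1`
and the `∂ₛ` have degree `-1`. -/
def degSpan (M : CoxeterMatrix B) (i j : ℕ) : Submodule ℝ (NilHecke M) :=
  Submodule.span ℝ {x | ∃ (p : List (B →₀ ℝ)) (ω : List B), p.length + i = ω.length + j ∧
    x = weightProd M p * delProd M ω}

theorem mem_degSpan {i j : ℕ} {p : List (B →₀ ℝ)} {ω : List B}
    (h : p.length + i = ω.length + j) : weightProd M p * delProd M ω ∈ degSpan M i j :=
  Submodule.subset_span ⟨p, ω, h, rfl⟩

/-- The relation between ∂ₛ and weights is homogeneous, so moving the weight to the left preserves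
the degree. -/
theorem delProd_mul_weight_mem (ω : List B) (l : B →₀ ℝ) :
    delProd M ω * weight M l ∈ degSpan M ω.length 1 := by
  induction ω using List.reverseRecOn generalizing l with
  | nil =>
    have := mem_degSpan (M := M) (i := 0) (j := 1) (p := [l]) (ω := []) (by simp)
    simpa [weightProd, delProd] using this
  | append_singleton ω s ih =>
    rw [delProd_append, mul_assoc, delProd_cons, delProd_nil, mul_one, del_mul_weight, mul_add,
      ← mul_assoc]
    refine add_mem ?_ ?_
    · have key : ∀ x ∈ degSpan M ω.length 1, x * del M s ∈ degSpan M (ω ++ [s]).length 1 := by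
        intro x hx
        induction hx using Submodule.span_induction with
        | mem x hx =>
          obtain ⟨p, ω', h, rfl⟩ := hx
          have := mem_degSpan (M := M) (i := (ω ++ [s]).length) (j := 1) (p := p) (ω := ω' ++ [s])
            (by simp; omega)
          rwa [delProd_append, ← mul_assoc, delProd_cons, delProd_nil, mul_one] at this
        | zero => rw [zero_mul]; exact zero_mem _
        | add x y _ _ hx hy => rw [add_mul]; exact add_mem hx hy
        | smul c x _ hx => rw [smul_mul_assoc]; exact Submodule.smul_mem _ _ hx
      exact key _ (ih _)
    · rw [← Algebra.commutes, ← Algebra.smul_def]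
      refine Submodule.smul_mem _ _ ?_
      have := mem_degSpan (M := M) (i := (ω ++ [s]).length) (j := 1) (p := []) (ω := ω)
        (by simp)
      simpa [weightProd] using this

theorem mul_weight_mem_degSpan {i j : ℕ} {x : NilHecke M} (hx : x ∈ degSpan M i j)
    (l : B →₀ ℝ) : x * weight M l ∈ degSpan M i (j + 1) := by
  induction hx using Submodule.span_induction with
  | mem x hx =>
    obtain ⟨p, ω, h, rfl⟩ := hx
    rw [mul_assoc]
    have key : ∀ y ∈ degSpan M ω.length 1, weightProd M p * y ∈ degSpan M i (j + 1) := by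
      intro y hy
      induction hy using Submodule.span_induction with
      | mem y hy =>
        obtain ⟨p', ω', h', rfl⟩ := hy
        rw [← mul_assoc, ← weightProd_append]
        exact mem_degSpan (by simp; omega)
      | zero => rw [mul_zero]; exact zero_mem _
      | add x y _ _ hx hy => rw [mul_add]; exact add_mem hx hy
      | smul c x _ hx => rw [mul_smul_comm]; exact Submodule.smul_mem _ _ hx
    exact key _ (delProd_mul_weight_mem ω l)
  | zero => rw [zero_mul]; exact zero_mem _
  | add x y _ _ hx hy => rw [add_mul]; exact add_mem hx hy
  | smul c x _ hx => rw [smul_mul_assoc]; exact Submodule.smul_mem _ _ hx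

theorem mul_weightProd_mem_degSpan {i j : ℕ} {x : NilHecke M} (hx : x ∈ degSpan M i j)
    (p : List (B →₀ ℝ)) : x * weightProd M p ∈ degSpan M i (j + p.length) := by
  induction p generalizing j x with
  | nil => simpa [weightProd] using hx
  | cons l p ih =>
    have := ih (mul_weight_mem_degSpan hx l)
    rw [mul_assoc] at this
    rw [List.length_cons, add_comm p.length 1, ← add_assoc]
    simpa [weightProd] using this

/-- The span of the products of `n` weights and `n` elements `∂ₛ`, for `n ≥ k`. -/
def balancedSpan (M : CoxeterMatrix B) (k : ℕ) : Submodule ℝ (NilHecke M) :=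
  Submodule.span ℝ {x | ∃ (p : List (B →₀ ℝ)) (ω : List B), p.length = ω.length ∧
    k ≤ ω.length ∧ x = weightProd M p * delProd M ω}

/-- In degree zero a product without any ∂ₛ has no weights either, so it is 1. -/
theorem exists_add_balancedSpan {i : ℕ} {x : NilHecke M} (hx : x ∈ degSpan M i i) :
    ∃ r : ℝ, ∃ g ∈ balancedSpan M 1, x = algebraMap ℝ _ r + g := by
  induction hx using Submodule.span_induction with
  | mem x hx =>
    obtain ⟨p, ω, h, rfl⟩ := hx
    rcases ω with _ | ⟨s, ω⟩
    · have hp : p = [] := by rw [← List.length_eq_zero_iff]; simpa using h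
      subst hp
      exact ⟨1, 0, zero_mem _, by simp [weightProd, delProd]⟩
    · exact ⟨0, _, Submodule.subset_span ⟨p, s :: ω, by omega, by simp, rfl⟩, by simp⟩
  | zero => exact ⟨0, 0, zero_mem _, by simp⟩
  | add x y _ _ hx hy =>
    obtain ⟨r, g, hg, rfl⟩ := hx
    obtain ⟨r', g', hg', rfl⟩ := hy
    exact ⟨r + r', g + g', add_mem hg hg', by rw [map_add]; abel⟩
  | smul c x _ hx =>
    obtain ⟨r, g, hg, rfl⟩ := hx
    exact ⟨c * r, c • g, Submodule.smul_mem _ _ hg, by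
      rw [smul_add, map_mul, Algebra.smul_def, Algebra.smul_def]⟩

/-- Each product ends with some ∂ₛ, which kills 1. This lets the scalar part of a degree-zero
element be read off from its value at 1. -/
theorem nilHeckeRep_one_of_mem_balancedSpan {g : NilHecke M} (hg : g ∈ balancedSpan M 1) :
    nilHeckeRep cs g 1 = 0 := by
  induction hg using Submodule.span_induction with
  | mem x hx =>
    obtain ⟨p, ω, -, h, rfl⟩ := hx
    rcases List.eq_nil_or_concat ω with rfl | ⟨ω, s, rfl⟩
    · simp at h
    · rw [List.concat_eq_append, delProd_append, delProd_cons, delProd_nil, mul_one, ← mul_assoc,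
        map_mul, Module.End.mul_apply, nilHeckeRep_del, demazure_one, map_zero]
  | zero => simp
  | add x y _ _ hx hy => rw [map_add, LinearMap.add_apply, hx, hy, add_zero]
  | smul c x _ hx => rw [map_smul, LinearMap.smul_apply, hx, smul_zero]

/-- Multiplying r + g by the weights on the left and by the ∂ₛ on the right expresses r times the
product modulo `I` through longer products. The weights of g stay on the left, so no reordering
occurs. -/
theorem balancedSpan_le_sup {I : Submodule ℝ (NilHecke M)}
    (hI : ∀ x ∈ I, ∀ y z, y * x * z ∈ I) {r : ℝ} (hr : r ≠ 0) {g : NilHecke M}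
    (hg : g ∈ balancedSpan M 1) (hx : algebraMap ℝ _ r + g ∈ I) (k : ℕ) :
    balancedSpan M k ≤ balancedSpan M (k + 1) ⊔ I := by
  refine Submodule.span_le.mpr ?_
  rintro _ ⟨p, ω, h, hk, rfl⟩
  have h1 : weightProd M p * g * delProd M ω ∈ balancedSpan M (k + 1) := by
    clear hx
    induction hg using Submodule.span_induction with
    | mem x hx =>
      obtain ⟨p', ω', h', hk', rfl⟩ := hx
      rw [← mul_assoc, ← weightProd_append, mul_assoc, ← delProd_append]
      exact Submodule.subset_span ⟨_, _, by simp; omega, by simp; omega, rfl⟩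
    | zero => rw [mul_zero, zero_mul]; exact zero_mem _
    | add x y _ _ hx hy => rw [mul_add, add_mul]; exact add_mem hx hy
    | smul c x _ hx => rw [mul_smul_comm, smul_mul_assoc]; exact Submodule.smul_mem _ _ hx
  have h2 := hI _ hx (weightProd M p) (delProd M ω)
  have h3 : weightProd M p * delProd M ω =
      r⁻¹ • (-(weightProd M p * g * delProd M ω) +
        weightProd M p * (algebraMap ℝ _ r + g) * delProd M ω) := by
    rw [mul_add, add_mul, ← Algebra.commutes, ← Algebra.smul_def, smul_mul_assoc]
    rw [add_comm (r • _), ← add_assoc, neg_add_cancel, zero_add, smul_smul, inv_mul_cancel₀ hr,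
      one_smul]
  rw [SetLike.mem_coe, h3]
  exact Submodule.smul_mem _ _ (add_mem (Submodule.mem_sup_left (neg_mem h1))
    (Submodule.mem_sup_right h2))

/-- A two-sided ideal that contains `r + g`, with a real number `r ≠ 0` and `g` a combination of
products of `n ≥ 1` weights and `n` elements `∂ₛ`, contains `1`. -/
theorem one_mem_of_add_mem (cs : CoxeterSystem M W) {n : ℕ} (hn : ∀ w, cs.length w ≤ n)
    {I : Submodule ℝ (NilHecke M)}
    (hI : ∀ x ∈ I, ∀ y z, y * x * z ∈ I) {r : ℝ} (hr : r ≠ 0) {g : NilHecke M}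
    (hg : g ∈ balancedSpan M 1) (hx : algebraMap ℝ _ r + g ∈ I) : 1 ∈ I := by
  -- Words of more than `n` factors ∂ₛ vanish; this starts a descent on the number of factors down
  -- to 1, where it reaches `g` itself.
  have h0 : balancedSpan M (n + 1) ≤ I := by
    refine Submodule.span_le.mpr ?_
    rintro _ ⟨p, ω, h, hk, rfl⟩
    rw [delProd_eq_zero_of_lt_length cs hn hk, mul_zero]
    exact zero_mem I
  have h1 : ∀ j, j ≤ n → balancedSpan M (n + 1 - j) ≤ I := by
    intro j
    induction j with
    | zero => exact fun _ => h0
    | succ j ih =>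
      intro hj
      refine (balancedSpan_le_sup hI hr hg hx _).trans (sup_le ?_ le_rfl)
      rw [show n + 1 - (j + 1) + 1 = n + 1 - j by omega]
      exact ih (by omega)
  have h2 := h1 n le_rfl
  rw [Nat.add_sub_cancel_left] at h2
  have h3 := I.smul_mem r⁻¹ (I.sub_mem hx (h2 hg))
  rwa [add_sub_cancel_right, Algebra.algebraMap_eq_smul_one, smul_smul, inv_mul_cancel₀ hr,
    one_smul] at h3

end NilHecke

end Words

/-! ### Demazure operators over the fraction field -/

section LongestElement

variable {B : Type u} {M : CoxeterMatrix B} {W : Type v} [Group W] (cs : CoxeterSystem M W)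

open NilHecke

theorem symAction_injective : Function.Injective (symAction cs) := by
  intro w w' h
  refine geomRep_injective cs (LinearMap.ext fun l => SymmetricAlgebra.ι_injective (S := ℝ) ?_)
  rw [← symAction_ι, ← symAction_ι, h]

theorem symAction_apply_injective (w : W) : Function.Injective (symAction cs w) := by
  intro f g h
  have := congrArg (symAction cs w⁻¹) h
  rwa [← AlgHom.mul_apply, ← AlgHom.mul_apply, ← map_mul, inv_mul_cancel, map_one] at this

theorem symAction_prod (w : W) (p : List (B →₀ ℝ)) :
    symAction cs w (p.map (SymmetricAlgebra.ι ℝ (B →₀ ℝ))).prod =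
      ((p.map fun l => geomRep cs w l).map (SymmetricAlgebra.ι ℝ (B →₀ ℝ))).prod := by
  induction p with
  | nil => simp
  | cons l p ih => simp only [List.map_cons, List.prod_cons, map_mul, ih, symAction_ι]

/-- The action of `w` on the fraction field of `R`. -/
noncomputable def fracAction (w : W) : FractionRing (SymR B) →+* FractionRing (SymR B) :=
  IsLocalization.map (M := nonZeroDivisors (SymR B)) (T := nonZeroDivisors (SymR B)) _
    (symAction cs w : SymR B →+* SymR B)
    (nonZeroDivisors_le_comap_nonZeroDivisors_of_injective _ (symAction_apply_injective cs w))

theorem fracAction_algebraMap (w : W) (f : SymR B) :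
    fracAction cs w (algebraMap (SymR B) (FractionRing (SymR B)) f) =
      algebraMap _ _ (symAction cs w f) :=
  IsLocalization.map_eq _ f

theorem algebraMap_demazure (s : B) (f : SymR B) :
    algebraMap (SymR B) (FractionRing (SymR B)) (demazure cs s f) =
      (algebraMap _ _ (SymmetricAlgebra.ι ℝ _ (simpleRoot s)))⁻¹ *
        (algebraMap _ _ f - fracAction cs (cs.simple s) (algebraMap _ _ f)) := by
  have h0 : algebraMap (SymR B) (FractionRing (SymR B))
      (SymmetricAlgebra.ι ℝ _ (simpleRoot s)) ≠ 0 := by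
    rw [Ne, FaithfulSMul.algebraMap_eq_zero_iff]
    exact ι_simpleRoot_ne_zero s
  rw [eq_inv_mul_iff_mul_eq₀ h0, ← map_mul, ι_mul_demazure, map_sub, fracAction_algebraMap]

/-- Dedekind's independence of characters applies, since W acts faithfully on R. -/
theorem linearIndependent_symAction :
    LinearIndependent (FractionRing (SymR B))
      (fun (w : W) (f : SymR B) => algebraMap (SymR B) (FractionRing (SymR B))
        (symAction cs w f)) := by
  have h := (linearIndependent_monoidHom (SymR B) (FractionRing (SymR B))).comp
    (fun w : W => ((algebraMap (SymR B) (FractionRing (SymR B))).comp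
      (symAction cs w : SymR B →+* SymR B) : SymR B →* FractionRing (SymR B))) (by
    intro w w' h
    refine symAction_injective cs (AlgHom.ext fun f => ?_)
    exact FaithfulSMul.algebraMap_injective (SymR B) (FractionRing (SymR B))
      (DFunLike.congr_fun h f))
  exact h

variable [Fintype W]

/-- A product of Demazure operators as a combination of the elements of `W` with coefficients in
the fraction field, with its leading coefficient. -/
theorem exists_algebraMap_nilHeckeRep_delProd_eq (ω : List B) :
    ∃ (c : W → FractionRing (SymR B)) (p : List (B →₀ ℝ)), p.length = ω.length ∧
      (∀ f, algebraMap _ _ (nilHeckeRep cs (delProd M ω) f) =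
        ∑ w, c w * algebraMap _ _ (symAction cs w f)) ∧
      (∀ w, ω.length < cs.length w → c w = 0) ∧
      (cs.IsReduced ω → c (cs.wordProd ω) *
        algebraMap _ _ (p.map (SymmetricAlgebra.ι ℝ (B →₀ ℝ))).prod = (-1) ^ ω.length) := by
  induction ω with
  | nil =>
    classical
    refine ⟨fun w => if w = 1 then 1 else 0, [], rfl, ?_, ?_, ?_⟩
    · intro f
      simp [delProd_nil]
    · intro w hw
      refine if_neg ?_
      rintro rfl
      simp at hw
    · simp
  | cons s ω ih =>
    obtain ⟨c, p, hp, hc, hsupp, hlead⟩ := ih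
    set α := algebraMap (SymR B) (FractionRing (SymR B)) (SymmetricAlgebra.ι ℝ _ (simpleRoot s))
      with hα
    have hα0 : α ≠ 0 := by
      rw [Ne, hα, FaithfulSMul.algebraMap_eq_zero_iff]
      exact ι_simpleRoot_ne_zero s
    -- These are the coefficients of αₛ⁻¹(1 - s) composed with Σ c(w) w. The denominator of the
    -- leading one is transformed by s and multiplied by αₛ.
    refine ⟨fun w => α⁻¹ * (c w - fracAction cs (cs.simple s) (c (cs.simple s * w))),
      simpleRoot s :: p.map (geomRep cs (cs.simple s)), by simp [hp], ?_, ?_, ?_⟩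
    · intro f
      rw [delProd_cons, map_mul, Module.End.mul_apply, nilHeckeRep_del, algebraMap_demazure, hc,
        map_sum, ← hα]
      have e : ∑ w, fracAction cs (cs.simple s) (c w * algebraMap _ _ (symAction cs w f)) =
          ∑ w, fracAction cs (cs.simple s) (c (cs.simple s * w)) *
            algebraMap _ _ (symAction cs w f) := by
        rw [← Equiv.sum_comp (Equiv.mulLeft (cs.simple s))]
        refine Finset.sum_congr rfl fun w _ => ?_
        rw [Equiv.coe_mulLeft, map_mul, fracAction_algebraMap, ← AlgHom.mul_apply,
          ← map_mul (symAction cs), cs.simple_mul_simple_cancel_left]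
      rw [e, ← Finset.sum_sub_distrib, Finset.mul_sum]
      refine Finset.sum_congr rfl fun w _ => ?_
      ring
    · intro w hw
      rw [List.length_cons] at hw
      have := cs.length_simple_mul w s
      dsimp only
      rw [hsupp w (by omega), hsupp (cs.simple s * w) (by omega), map_zero, sub_zero, mul_zero]
    · intro hred
      have hred' : cs.IsReduced ω := by simpa using hred.drop 1
      have hl := hlead hred'
      -- The new leading element is too long to occur for `ω`, so only the reflected term
      -- contributes, with a sign.
      have h0 : c (cs.wordProd (s :: ω)) = 0 := hsupp _ (by rw [hred.eq]; simp)
      dsimp only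
      rw [h0, zero_sub, cs.wordProd_cons, cs.simple_mul_simple_cancel_left, List.map_cons,
        List.prod_cons, map_mul, ← hα, ← symAction_prod, ← fracAction_algebraMap,
        List.length_cons, pow_succ]
      have h1 := congrArg (fracAction cs (cs.simple s)) hl
      rw [map_mul, map_pow, map_neg, map_one] at h1
      rw [← h1]
      field_simp

/-- The operator has s-invariant values, so independence of the elements of W gives c(sw) = s(c(w)).
Starting from the leading coefficient ±1/Q at w₀, this gives c(ww₀) = ±1/w(Q) with a constant sign,
and at w₀⁻¹(Q) each of the |W| summands is the same sign. -/
theorem exists_nilHeckeRep_delProd_eq_algebraMap {ω : List B} (hω : cs.IsReduced ω)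
    (hd : ∀ s, del M s * delProd M ω = 0) :
    ∃ p : List (B →₀ ℝ), p.length = ω.length ∧ ∃ r : ℝ, r ≠ 0 ∧
      nilHeckeRep cs (delProd M ω) (p.map (SymmetricAlgebra.ι ℝ (B →₀ ℝ))).prod =
        algebraMap ℝ _ r := by
  obtain ⟨c, p, hp, hc, -, hlead⟩ := exists_algebraMap_nilHeckeRep_delProd_eq cs ω
  replace hlead := hlead hω
  set w₀ := cs.wordProd ω
  set Q := (p.map (SymmetricAlgebra.ι ℝ (B →₀ ℝ))).prod
  have hinv : ∀ s w, c (cs.simple s * w) = fracAction cs (cs.simple s) (c w) := by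
    intro s
    have key : ∑ w, (c w - fracAction cs (cs.simple s) (c (cs.simple s * w))) •
        (fun f : SymR B => algebraMap (SymR B) (FractionRing (SymR B)) (symAction cs w f)) = 0 := by
      -- Apply s to the expansion, whose left side is fixed, reindex the sum by w ↦ sw, and
      -- subtract.
      funext f
      have h1 : symAction cs (cs.simple s) (nilHeckeRep cs (delProd M ω) f) =
          nilHeckeRep cs (delProd M ω) f := by
        refine symAction_eq_of_demazure_eq_zero cs ?_
        rw [← nilHeckeRep_del, ← Module.End.mul_apply, ← map_mul, hd, map_zero,
          LinearMap.zero_apply]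
      have h2 := hc f
      have h3 := congrArg (fracAction cs (cs.simple s)) h2
      rw [fracAction_algebraMap, h1, h2, map_sum,
        ← Equiv.sum_comp (Equiv.mulLeft (cs.simple s))
          (fun w => fracAction cs (cs.simple s) _)] at h3
      rw [Finset.sum_apply, Pi.zero_apply]
      simp only [Pi.smul_apply, smul_eq_mul, sub_mul, Finset.sum_sub_distrib]
      rw [sub_eq_zero, h3]
      refine Finset.sum_congr rfl fun w _ => ?_
      rw [Equiv.coe_mulLeft, map_mul, fracAction_algebraMap, ← AlgHom.mul_apply,
        ← map_mul (symAction cs), cs.simple_mul_simple_cancel_left]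
    intro w
    have := Fintype.linearIndependent_iff.mp (linearIndependent_symAction cs) _ key
      (cs.simple s * w)
    rwa [cs.simple_mul_simple_cancel_left, sub_eq_zero] at this
  have hcoef : ∀ w, c (w * w₀) * algebraMap _ _ (symAction cs w Q) = (-1) ^ ω.length := by
    intro w
    induction w using cs.simple_induction_left with
    | one => simpa using hlead
    | mul_simple_left w s hw =>
      have := congrArg (fracAction cs (cs.simple s)) hw
      rw [map_mul, fracAction_algebraMap, ← hinv, map_pow, map_neg, map_one] at this
      rw [mul_assoc, map_mul, AlgHom.mul_apply, this]
  refine ⟨p.map (geomRep cs w₀⁻¹), by simp [hp], (-1) ^ ω.length * Fintype.card W, ?_, ?_⟩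
  · exact mul_ne_zero (pow_ne_zero _ (by norm_num)) (by simp)
  · refine FaithfulSMul.algebraMap_injective (SymR B) (FractionRing (SymR B)) ?_
    rw [hc, ← symAction_prod, ← Equiv.sum_comp (Equiv.mulRight w₀)]
    have : ∀ w, c (w * w₀) * algebraMap (SymR B) (FractionRing (SymR B))
        (symAction cs (w * w₀) (symAction cs w₀⁻¹ Q)) = (-1) ^ ω.length := by
      intro w
      rw [← AlgHom.mul_apply, ← map_mul, mul_inv_cancel_right]
      exact hcoef w
    refine (Finset.sum_congr rfl fun w _ => this w).trans ?_
    rw [Finset.sum_const, Finset.card_univ, nsmul_eq_mul]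
    simp only [map_mul, map_pow, map_neg, map_one, map_natCast]
    ring

end LongestElement

/-! ### The dual basis of R over the invariants -/

section DualBasis

variable {B : Type u} {M : CoxeterMatrix B} {W : Type v} [Group W] (cs : CoxeterSystem M W)

open NilHecke

/-- The ideal of the longest product `d` is everything, and a decomposition of 1 in it is a dual
basis, because left multiplication on `R d` is given by ρ. The element `e` is for the retraction
onto the invariants. -/
theorem exists_dualBasis [Finite W] :
    ∃ (n : ℕ) (a : Fin n → SymR B) (c : Fin n → NilHecke M) (e : NilHecke M),
      (∀ i f, nilHeckeRep cs (c i) f ∈ invariants cs) ∧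
      (∀ h, h = ∑ i, nilHeckeRep cs h (a i) • c i) ∧
      (∀ f, nilHeckeRep cs e f ∈ invariants cs) ∧ nilHeckeRep cs e 1 = 1 := by
  have := Fintype.ofFinite W
  obtain ⟨w₀, hw₀⟩ := Finite.exists_max cs.length
  obtain ⟨ω, hω, rfl⟩ := cs.exists_isReduced w₀
  rw [hω.eq] at hw₀
  set d := delProd M ω with hd_def
  have hd : ∀ s, del M s * d = 0 := fun s => by
    rw [hd_def, ← delProd_cons]
    exact delProd_eq_zero_of_lt_length cs hw₀ (by simp)
  have hinv : ∀ y f, nilHeckeRep cs (d * y) f ∈ invariants cs := fun y f =>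
    mem_invariants_of_demazure cs fun s => by
      rw [← nilHeckeRep_del, ← Module.End.mul_apply, ← map_mul, ← mul_assoc, hd, zero_mul,
        map_zero, LinearMap.zero_apply]
  obtain ⟨p, hp, r, hr, hrep⟩ := exists_nilHeckeRep_delProd_eq_algebraMap cs hω hd
  -- As many weights as ∂ₛ: the product has degree zero, hence is a scalar plus a balanced part.
  have hdp : d * weightProd M p ∈ degSpan M ω.length ω.length := by
    have h1 : d ∈ degSpan M ω.length 0 := by
      have := mem_degSpan (M := M) (i := ω.length) (j := 0) (p := []) (ω := ω) (by simp)
      simpa [weightProd] using this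
    have := mul_weightProd_mem_degSpan h1 p
    rwa [zero_add, hp] at this
  obtain ⟨r', g, hg, hr'⟩ := exists_add_balancedSpan hdp
  have hdp1 : nilHeckeRep cs (d * weightProd M p) 1 = algebraMap ℝ _ r := by
    rw [← ofSym_prod, map_mul, Module.End.mul_apply, nilHeckeRep_ofSym, mul_one, hrep]
  -- The balanced part kills 1, so the scalar is the value at 1.
  have hrr' : r' = r := by
    have h1 := hdp1
    rw [hr', map_add, LinearMap.add_apply, nilHeckeRep_one_of_mem_balancedSpan cs hg, add_zero,
      AlgHom.commutes, algebraMap_end_invariants_apply, mul_one] at h1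
    exact FaithfulSMul.algebraMap_injective ℝ (SymR B) h1
  rw [hrr'] at hr'
  let I : Submodule ℝ (NilHecke M) := Submodule.span ℝ {x | ∃ y z, x = y * d * z}
  have hI : ∀ x ∈ I, ∀ y z, y * x * z ∈ I := by
    intro x hx y z
    induction hx using Submodule.span_induction with
    | mem x hx =>
      obtain ⟨y', z', rfl⟩ := hx
      exact Submodule.subset_span ⟨y * y', z' * z, by simp only [mul_assoc]⟩
    | zero => rw [mul_zero, zero_mul]; exact zero_mem _
    | add a b _ _ ha hb => rw [mul_add, add_mul]; exact add_mem ha hb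
    | smul c a _ ha => rw [mul_smul_comm, smul_mul_assoc]; exact Submodule.smul_mem _ _ ha
  have hone : (1 : NilHecke M) ∈ I := by
    refine one_mem_of_add_mem cs hw₀ hI hr hg ?_
    rw [← hr']
    exact Submodule.subset_span ⟨1, weightProd M p, by rw [one_mul]⟩
  obtain ⟨n, k, x, hx⟩ := Submodule.mem_span_set'.mp hone
  choose y z hyz using fun i => (x i).2
  -- From 1 = Σ kᵢ yᵢ d zᵢ follows h = Σ (h kᵢ yᵢ d) zᵢ, and h kᵢ yᵢ acts on `d` through its value
  -- at 1. The factor `r⁻¹` normalizes `e` to fix 1.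
  refine ⟨n, fun i => nilHeckeRep cs (k i • y i) 1, fun i => d * z i, r⁻¹ • (d * weightProd M p),
    fun i f => hinv _ f, fun h => ?_, fun f => ?_, ?_⟩
  · calc h = h * ∑ i, k i • (x i : NilHecke M) := by rw [hx, mul_one]
      _ = ∑ i, (h * (k i • y i) * ((1 : SymR B) • d)) * z i := by
        rw [Finset.mul_sum]
        refine Finset.sum_congr rfl fun i _ => ?_
        rw [hyz, one_smul, mul_smul_comm, mul_smul_comm, smul_mul_assoc, smul_mul_assoc]
        simp only [mul_assoc]
      _ = _ := by
        refine Finset.sum_congr rfl fun i _ => ?_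
        rw [mul_smul_eq_of_del_mul_eq_zero cs hd, smul_mul_assoc, map_mul, Module.End.mul_apply]
  · rw [map_smul, LinearMap.smul_apply]
    exact Subalgebra.smul_mem _ (hinv _ f) _
  · rw [map_smul, LinearMap.smul_apply, hdp1, Algebra.algebraMap_eq_smul_one, smul_smul,
      inv_mul_cancel₀ hr, one_smul]

end DualBasis

/-! ### The bialgebroid of a dual basis -/

/-- A representation of a ring `H` over `R` by `R'`-linear endomorphisms of `R`, with elements
`aᵢ` of `R` and `cᵢ` of `H` that form a dual basis of `R` over `R'` and expand all of `H`. -/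
structure IsDualBasisRep {R' R H : Type*} [CommRing R'] [CommRing R] [Algebra R' R] [Ring H]
    [Module R H] (ρ : H →+* Module.End R' R) {n : ℕ} (a : Fin n → R) (c : Fin n → H) : Prop where
  smul_apply : ∀ (r : R) (h : H) (f : R), ρ (r • h) f = r * ρ h f
  exists_algebraMap : ∀ i f, ∃ r' : R', ρ (c i) f = algebraMap R' R r'
  eq_sum : ∀ h, h = ∑ i, ρ h (a i) • c i

namespace IsDualBasisRep

section

variable {R' R H : Type*} [CommRing R'] [CommRing R] [Algebra R' R] [Ring H] [Module R H]
  {ρ : H →+* Module.End R' R} {n : ℕ} {a : Fin n → R} {c : Fin n → H}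
  (D : IsDualBasisRep ρ a c)

theorem injective (D : IsDualBasisRep ρ a c) : Function.Injective ρ := by
  intro g h hgh
  rw [D.eq_sum g, D.eq_sum h, hgh]

theorem sum_mul (D : IsDualBasisRep ρ a c) (f : R) : ∑ i, a i * ρ (c i) f = f := by
  have h := congrArg (fun h => ρ h f) (D.eq_sum 1)
  simp only [map_sum, LinearMap.sum_apply, D.smul_apply, map_one, Module.End.one_apply] at h
  exact h.symm

theorem map_mul_apply (D : IsDualBasisRep ρ a c) (h : H) (i : Fin n) (f g : R) :
    ρ h (g * ρ (c i) f) = ρ h g * ρ (c i) f := by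
  obtain ⟨r, hr⟩ := D.exists_algebraMap i f
  rw [hr, mul_comm, ← Algebra.smul_def, map_smul, Algebra.smul_def, mul_comm]

theorem mul_smul_one_apply (D : IsDualBasisRep ρ a c) (h : H) (r f : R) :
    ρ (h * (r • (1 : H))) f = ρ h (r * f) := by
  rw [map_mul, Module.End.mul_apply, D.smul_apply, map_one, Module.End.one_apply]

/-- Apply φ to f = Σ aᵢ cᵢ(f): the cᵢ(f) are scalars from R', so φ is determined by the values
φ(aᵢ). -/
theorem surjective (D : IsDualBasisRep ρ a c) : Function.Surjective ρ := by
  intro φ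
  refine ⟨∑ i, φ (a i) • c i, LinearMap.ext fun f => ?_⟩
  rw [map_sum, LinearMap.sum_apply]
  conv_rhs => rw [← D.sum_mul f, map_sum]
  refine Finset.sum_congr rfl fun i _ => ?_
  obtain ⟨r, hr⟩ := D.exists_algebraMap i f
  rw [D.smul_apply, hr, mul_comm, ← Algebra.smul_def, mul_comm, ← Algebra.smul_def, map_smul]

/-- The `R`-linear map `h ↦ ρ h f`. -/
def evalAt (f : R) : H →ₗ[R] R where
  toFun h := ρ h f
  map_add' g h := by rw [map_add, LinearMap.add_apply]
  map_smul' r h := D.smul_apply r h f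

theorem evalAt_apply (f : R) (h : H) : D.evalAt f h = ρ h f := rfl

/-- Evaluation of the left tensor factor. -/
def slice (N : Type*) [AddCommGroup N] [Module R N] (f : R) : H ⊗[R] N →ₗ[R] N :=
  (TensorProduct.lid R N).toLinearMap ∘ₗ (D.evalAt f).rTensor N

theorem slice_tmul {N : Type*} [AddCommGroup N] [Module R N] (f : R) (h : H) (x : N) :
    D.slice N f (h ⊗ₜ x) = ρ h f • x := by
  simp [slice, evalAt_apply]

/-- The expansion of H gives y = Σ cᵢ ⊗ slice(aᵢ)(y) on H ⊗ N. -/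
theorem slice_ext {N : Type*} [AddCommGroup N] [Module R N] {y z : H ⊗[R] N}
    (h : ∀ f, D.slice N f y = D.slice N f z) : y = z := by
  have key : ∀ y : H ⊗[R] N, y = ∑ i, c i ⊗ₜ D.slice N (a i) y := by
    intro y
    induction y with
    | zero => simp
    | add y z hy hz =>
      simp only [map_add, TensorProduct.tmul_add, Finset.sum_add_distrib, ← hy, ← hz]
    | tmul h x =>
      simp only [D.slice_tmul, ← TensorProduct.smul_tmul]
      rw [← TensorProduct.sum_tmul, ← D.eq_sum]
  rw [key y, key z]
  simp only [h]

/-- The pairing `∑ xᵢ ⊗ yᵢ ↦ ∑ ρ xᵢ f * ρ yᵢ g`. -/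
def pairing (f g : R) : H ⊗[R] H →ₗ[R] R := D.evalAt g ∘ₗ D.slice H f

theorem pairing_tmul (f g : R) (x y : H) : D.pairing f g (x ⊗ₜ y) = ρ x f * ρ y g := by
  rw [pairing, LinearMap.comp_apply, slice_tmul, evalAt_apply, D.smul_apply]

/-- This reduces identities in H ⊗ H, such as those for the comultiplication, to identities in R. -/
theorem pairing_ext {y z : H ⊗[R] H} (h : ∀ f g, D.pairing f g y = D.pairing f g z) : y = z :=
  D.slice_ext fun f => D.injective <| LinearMap.ext fun g => h f g

/-- The comultiplication dual to the multiplication of `R`. -/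
def comul : H →ₗ[R] H ⊗[R] H :=
  ∑ i, ∑ j, (D.evalAt (a i * a j)).smulRight (c i ⊗ₜ c j)

/-- Expand f and g in the dual basis; the coefficients lie in R' and pass through `ρ h`. By
`pairing_ext` this property characterizes the comultiplication. -/
theorem pairing_comul (f g : R) (h : H) : D.pairing f g (D.comul h) = ρ h (f * g) := by
  have e : f * g = ∑ i, ∑ j, a i * a j * ρ (c j) g * ρ (c i) f := by
    conv_lhs => rw [← D.sum_mul f, ← D.sum_mul g, Finset.sum_mul_sum]
    refine Finset.sum_congr rfl fun i _ => Finset.sum_congr rfl fun j _ => ?_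
    ring
  rw [e]
  simp only [comul, LinearMap.sum_apply, LinearMap.smulRight_apply, map_sum, map_smul,
    pairing_tmul, evalAt_apply, D.map_mul_apply, smul_eq_mul]
  refine Finset.sum_congr rfl fun i _ => Finset.sum_congr rfl fun j _ => ?_
  ring

theorem slice_one_comul (h : H) : D.slice H 1 (D.comul h) = h :=
  D.injective <| LinearMap.ext fun g => by
    have := D.pairing_comul 1 g h
    rwa [one_mul] at this

theorem comm_comul (h : H) : TensorProduct.comm R H H (D.comul h) = D.comul h := by
  have key : ∀ f g z, D.pairing f g (TensorProduct.comm R H H z) = D.pairing g f z := by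
    intro f g z
    induction z with
    | zero => simp
    | add y z hy hz => simp only [map_add, hy, hz]
    | tmul x y => rw [TensorProduct.comm_tmul, pairing_tmul, pairing_tmul, mul_comm]
  refine D.pairing_ext fun f g => ?_
  rw [key, pairing_comul, pairing_comul, mul_comm]

/-- The coalgebra structure dual to the algebra structure of `R`. -/
abbrev coalgebra : Coalgebra R H where
  comul := D.comul
  counit := D.evalAt 1
  coassoc := by
    -- Tested on three functions, coassociativity becomes (f g) k = f (g k).
    refine LinearMap.ext fun h => D.slice_ext fun f => D.slice_ext fun g =>
      D.injective <| LinearMap.ext fun k => ?_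
    change D.pairing g k (D.slice _ f _) = D.pairing g k (D.slice _ f _)
    have h1 : ∀ z, D.pairing g k (D.slice _ f
        (TensorProduct.assoc R H H H (D.comul.rTensor H z))) = D.pairing (f * g) k z := by
      intro z
      induction z with
      | zero => simp
      | add y z hy hz => simp only [map_add, hy, hz]
      | tmul x y =>
        have h2 : ∀ u, D.pairing g k (D.slice _ f (TensorProduct.assoc R H H H (u ⊗ₜ y))) =
            D.pairing f g u * ρ y k := by
          intro u
          induction u with
          | zero => simp
          | add y z hy hz => simp only [map_add, TensorProduct.add_tmul, add_mul, hy, hz]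
          | tmul x x' =>
            rw [TensorProduct.assoc_tmul, slice_tmul, map_smul, pairing_tmul, pairing_tmul,
              smul_eq_mul, mul_assoc]
        rw [LinearMap.rTensor_tmul, h2, pairing_comul, pairing_tmul]
    have h3 : ∀ z, D.pairing g k (D.slice _ f (D.comul.lTensor H z)) = D.pairing f (g * k) z := by
      intro z
      induction z with
      | zero => simp
      | add y z hy hz => simp only [map_add, hy, hz]
      | tmul x y =>
        rw [LinearMap.lTensor_tmul, slice_tmul, map_smul, pairing_comul, pairing_tmul,
          smul_eq_mul]
    refine (h1 _).trans (Eq.trans ?_ (h3 _).symm)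
    rw [pairing_comul, pairing_comul, mul_assoc]
  rTensor_counit_comp_comul := by
    refine LinearMap.ext fun h => (TensorProduct.lid R H).injective ?_
    refine (D.slice_one_comul h).trans ?_
    simp
  lTensor_counit_comp_comul := by
    refine LinearMap.ext fun h => (TensorProduct.rid R H).injective ?_
    have key : ∀ f z, ρ (TensorProduct.rid R H ((D.evalAt 1).lTensor H z)) f =
        D.pairing f 1 z := by
      intro f z
      induction z with
      | zero => simp
      | add y z hy hz => simp only [map_add, LinearMap.add_apply, hy, hz]
      | tmul x y =>
        rw [LinearMap.lTensor_tmul, TensorProduct.rid_tmul, D.smul_apply, pairing_tmul, evalAt_apply,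
          mul_comm]
    refine Eq.trans (D.injective (LinearMap.ext fun f => ?_))
      (show h = _ by simp)
    refine (key f _).trans ?_
    rw [pairing_comul, mul_one]

end

section

variable {R' R H : Type*} [CommRing R'] [CommRing R] [Algebra R' R] [Ring H] [Module R H]
  [IsScalarTower R H H] {ρ : H →+* Module.End R' R} {n : ℕ} {a : Fin n → R} {c : Fin n → H}
  (D : IsDualBasisRep ρ a c)

/-- Under the pairing, the Takeuchi condition is (r f) g = f (r g). -/
theorem comul_mem_takeuchi (h : H) : D.comul h ∈ takeuchi R H := by
  intro r
  have key : ∀ f g z, D.pairing f g ((LinearMap.mulRight R (r • (1 : H))).rTensor H z) =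
      D.pairing (r * f) g z := by
    intro f g z
    induction z with
    | zero => simp
    | add y z hy hz => simp only [map_add, hy, hz]
    | tmul x y =>
      rw [LinearMap.rTensor_tmul, pairing_tmul, pairing_tmul, LinearMap.mulRight_apply,
        D.mul_smul_one_apply]
  have key' : ∀ f g z, D.pairing f g ((LinearMap.mulRight R (r • (1 : H))).lTensor H z) =
      D.pairing f (r * g) z := by
    intro f g z
    induction z with
    | zero => simp
    | add y z hy hz => simp only [map_add, hy, hz]
    | tmul x y =>
      rw [LinearMap.lTensor_tmul, pairing_tmul, pairing_tmul, LinearMap.mulRight_apply,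
        D.mul_smul_one_apply]
  refine D.pairing_ext fun f g => ?_
  rw [key, key', pairing_comul, pairing_comul]
  congr 1
  ring

theorem pairing_takeuchiAct (f k : R) (x : takeuchi R H) (y z : H) :
    D.pairing f k (takeuchiAct x (y ⊗ₜ[R] z)) = D.pairing (ρ y f) (ρ z k) x.1 := by
  rw [takeuchiAct_tmul]
  generalize x.1 = x
  induction x with
  | zero => simp
  | add u v hu hv => simp only [map_add, hu, hv]
  | tmul u v =>
    simp only [TensorProduct.map_tmul, orbitMap_apply, smul_eq_mul, pairing_tmul, map_mul,
      Module.End.mul_apply]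

/-- The bialgebroid structure dual to the algebra structure of `R`. -/
def bialgebroid : Bialgebroid R H where
  toCoalgebra := D.coalgebra
  comul_mem := D.comul_mem_takeuchi
  comul_one := D.pairing_ext fun f g => by
    refine (D.pairing_comul f g 1).trans ?_
    simp [pairing_tmul]
  comul_mul g h := D.pairing_ext fun f k => by
    -- Under the pairing, multiplying by the coproduct of `g` amounts to applying `ρ g`, so
    -- multiplicativity follows from that of ρ.
    have key : ∀ z, D.pairing f k (takeuchiAct ⟨D.comul g, D.comul_mem_takeuchi g⟩ z) =
        ρ g (D.pairing f k z) := by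
      intro z
      induction z with
      | zero => simp
      | add u v hu hv => simp only [map_add, hu, hv]
      | tmul x y => rw [pairing_takeuchiAct, pairing_comul, pairing_tmul]
    refine (D.pairing_comul f k _).trans (Eq.trans ?_ (key (D.comul h)).symm)
    rw [pairing_comul, map_mul ρ, Module.End.mul_apply]
  counit_mul g h r := by
    change ρ (g * h * (r • (1 : H))) 1 = ρ (g * (ρ (h * (r • (1 : H))) 1 • (1 : H))) 1
    rw [D.mul_smul_one_apply, D.mul_smul_one_apply, D.mul_smul_one_apply, map_mul ρ,
      Module.End.mul_apply, mul_one, mul_one]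
  counit_smul_one r r' := by
    change ρ ((r • (1 : H)) * (r' • (1 : H))) 1 = r * r'
    rw [D.mul_smul_one_apply, D.smul_apply, map_one, Module.End.one_apply, mul_one]

theorem bialgebroid_comul (h : H) : D.bialgebroid.comul h = D.comul h := rfl

theorem isCocomm_bialgebroid : D.bialgebroid.IsCocomm := ⟨D.comm_comul⟩

end

end IsDualBasisRep

/-! ### Morita equivalence -/

/-- A retraction `τ : R → R'` of `R'`-modules that comes from an element `e` of `H`. -/
structure IsRetractionRep {R' R H : Type*} [CommRing R'] [CommRing R] [Algebra R' R] [Ring H]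
    (ρ : H →+* Module.End R' R) (e : H) (τ : R →ₗ[R'] R') : Prop where
  apply_eq : ∀ f, ρ e f = algebraMap R' R (τ f)
  apply_one : τ 1 = 1

namespace IsRetractionRep

section

variable {R' R H : Type*} [CommRing R'] [CommRing R] [Algebra R' R] [Ring H]
  {ρ : H →+* Module.End R' R} {e : H} {τ : R →ₗ[R'] R'}

theorem lid_rTensor_one_tmul (E : IsRetractionRep ρ e τ) {N : Type*} [AddCommGroup N] [Module R' N]
    (x : N) : TensorProduct.lid R' N (τ.rTensor N ((1 : R) ⊗ₜ[R'] x)) = x := by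
  simp [E.apply_one]

/-- Values of τ are scalars from R' and move across the tensor sign. So `e` projects R ⊗ N onto 1 ⊗
N, which recovers N. -/
theorem rTensor_eq_one_tmul (E : IsRetractionRep ρ e τ) {N : Type*} [AddCommGroup N] [Module R' N]
    (z : R ⊗[R'] N) :
    (ρ e).rTensor N z = (1 : R) ⊗ₜ[R'] TensorProduct.lid R' N (τ.rTensor N z) := by
  induction z with
  | zero => simp
  | add y z hy hz => simp only [map_add, hy, hz, TensorProduct.tmul_add]
  | tmul r x =>
    rw [LinearMap.rTensor_tmul, LinearMap.rTensor_tmul, TensorProduct.lid_tmul, E.apply_eq,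
      Algebra.algebraMap_eq_smul_one, TensorProduct.smul_tmul]

end

section

variable {R' R H : Type*} [CommRing R'] [CommRing R] [Algebra R' R] [Ring H] [Module R H]
  {ρ : H →+* Module.End R' R} {n : ℕ} {a : Fin n → R} {c : Fin n → H} {e : H} {τ : R →ₗ[R'] R'}

theorem _root_.IsDualBasisRep.rTensor_smul_one (D : IsDualBasisRep ρ a c) {N : Type*}
    [AddCommGroup N] [Module R' N] (r : R) (z : R ⊗[R'] N) :
    (ρ (r • (1 : H))).rTensor N z = r • z := by
  induction z with
  | zero => simp
  | add y z hy hz => rw [map_add, hy, hz, smul_add]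
  | tmul f x =>
    rw [LinearMap.rTensor_tmul, D.smul_apply, map_one, Module.End.one_apply,
      TensorProduct.smul_tmul', smul_eq_mul]

/-- Equivariant maps between modules of the form `R ⊗[R'] N` come from `R'`-linear maps. -/
theorem exists_lTensor_eq (D : IsDualBasisRep ρ a c) (E : IsRetractionRep ρ e τ)
    {N N' : Type*} [AddCommGroup N] [Module R' N] [AddCommGroup N'] [Module R' N']
    (φ : R ⊗[R'] N →+ R ⊗[R'] N')
    (hφ : ∀ h z, φ ((ρ h).rTensor N z) = (ρ h).rTensor N' (φ z)) :
    ∃ f : N →ₗ[R'] N', ∀ z, φ z = f.lTensor R z := by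
  have hsmul : ∀ (r : R) z, φ (r • z) = r • φ z := fun r z => by
    rw [← D.rTensor_smul_one, hφ, D.rTensor_smul_one]
  have hsmul' : ∀ (r : R') z, φ (r • z) = r • φ z := fun r z => by
    rw [← algebraMap_smul R r z, hsmul, algebraMap_smul]
  -- Restrict φ to 1 ⊗ N and read off the second factor by τ; since φ commutes with `e`, it maps 1 ⊗
  -- N into 1 ⊗ N'.
  let f : N →ₗ[R'] N' :=
    { toFun := fun x => TensorProduct.lid R' N' (τ.rTensor N' (φ ((1 : R) ⊗ₜ[R'] x)))
      map_add' := fun x y => by simp only [TensorProduct.tmul_add, map_add]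
      map_smul' := fun r x => by
        rw [TensorProduct.tmul_smul, hsmul', map_smul, map_smul, RingHom.id_apply] }
  refine ⟨f, fun z => ?_⟩
  induction z with
  | zero => simp
  | add y z hy hz => rw [map_add, map_add, hy, hz]
  | tmul r x =>
    have h1 : φ ((1 : R) ⊗ₜ[R'] x) = (1 : R) ⊗ₜ[R'] f x := by
      have := hφ e ((1 : R) ⊗ₜ[R'] x)
      rw [E.rTensor_eq_one_tmul, E.rTensor_eq_one_tmul, E.lid_rTensor_one_tmul] at this
      exact this
    have h2 : r ⊗ₜ[R'] x = r • ((1 : R) ⊗ₜ[R'] x) := by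
      rw [TensorProduct.smul_tmul', smul_eq_mul, mul_one]
    rw [h2, hsmul, h1, ← h2, LinearMap.lTensor_tmul, TensorProduct.smul_tmul', smul_eq_mul,
      mul_one]

/-- The values of cᵢ lie in R', where `e` acts as the identity. -/
theorem mul_dual_eq (D : IsDualBasisRep ρ a c) (E : IsRetractionRep ρ e τ) (i : Fin n) :
    e * c i = c i := by
  refine D.injective (LinearMap.ext fun f => ?_)
  obtain ⟨r, hr⟩ := D.exists_algebraMap i f
  have hτ : τ (algebraMap R' R r) = r := by
    rw [Algebra.algebraMap_eq_smul_one, map_smul, E.apply_one, smul_eq_mul, mul_one]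
  rw [map_mul, Module.End.mul_apply, hr, E.apply_eq, hτ]

variable [IsScalarTower R H H]

/-- The operator `e` has values in R', and `ρ h` is R'-linear. Hence on vectors fixed by `e`,
applying h after r is multiplication by ρ(h)(r). -/
theorem smul_one_mul_eq (D : IsDualBasisRep ρ a c) (E : IsRetractionRep ρ e τ) (h : H) (r : R) :
    (ρ h r • (1 : H)) * e = h * ((r • (1 : H)) * e) := by
  refine D.injective (LinearMap.ext fun f => ?_)
  rw [smul_one_mul, smul_one_mul, D.smul_apply, map_mul, Module.End.mul_apply, D.smul_apply,
    E.apply_eq, mul_comm r, ← Algebra.smul_def, map_smul, Algebra.smul_def, mul_comm]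

theorem _root_.IsDualBasisRep.algebraMap_smul_one_mul (D : IsDualBasisRep ρ a c) (r : R') (h : H) :
    (algebraMap R' R r • (1 : H)) * h = h * (algebraMap R' R r • (1 : H)) := by
  refine D.injective (LinearMap.ext fun f => ?_)
  rw [D.mul_smul_one_apply, smul_one_mul, D.smul_apply, ← Algebra.smul_def, ← Algebra.smul_def,
    map_smul]

/-- Every `H`-module is of the form `R ⊗[R'] N`. -/
theorem exists_equivariant_equiv (D : IsDualBasisRep ρ a c) (E : IsRetractionRep ρ e τ)
    {V : Type*} [AddCommGroup V] [Module H V] [Module R' V]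
    (hV : ∀ (r : R') (x : V), r • x = (algebraMap R' R r • (1 : H)) • x) :
    ∃ (N : Submodule R' V) (ψ : R ⊗[R'] N →+ V), Function.Bijective ψ ∧
      ∀ h z, ψ ((ρ h).rTensor N z) = h • ψ z := by
  -- The vectors fixed by `e`, which are 1 ⊗ N in the model R ⊗ N.
  let N : Submodule R' V :=
    { carrier := {x | e • x = x}
      zero_mem' := smul_zero e
      add_mem' := fun {x y} hx hy => by
        change e • (x + y) = x + y
        rw [smul_add, show e • x = x from hx, show e • y = y from hy]
      smul_mem' := fun r x hx => by
        change e • r • x = r • x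
        rw [hV, ← mul_smul, ← D.algebraMap_smul_one_mul, mul_smul, show e • x = x from hx] }
  have hmem : ∀ i (x : V), c i • x ∈ N := fun i x => by
    change e • c i • x = c i • x
    rw [← mul_smul, E.mul_dual_eq D]
  have hN : ∀ (h : H) (r : R) (x : N),
      (ρ h r • (1 : H)) • (x : V) = h • (r • (1 : H)) • (x : V) := fun h r x => by
    have hx : e • (x : V) = x := x.2
    have := congrArg (fun y => y • (x : V)) (E.smul_one_mul_eq D h r)
    simpa only [mul_smul, hx] using this
  let ψ : R ⊗[R'] N →ₗ[R'] V := TensorProduct.lift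
    (LinearMap.mk₂ R' (fun (r : R) (x : N) => (r • (1 : H)) • (x : V))
      (fun r r' x => by rw [add_smul, add_smul])
      (fun k r x => by
        rw [hV, ← mul_smul, smul_one_mul, Algebra.smul_def, mul_smul])
      (fun r x y => by rw [Submodule.coe_add, smul_add])
      (fun k r x => by
        rw [Submodule.coe_smul, hV, hV, ← mul_smul, ← mul_smul, D.algebraMap_smul_one_mul]))
  have hψ : ∀ (r : R) (x : N), ψ (r ⊗ₜ x) = (r • (1 : H)) • (x : V) := fun r x => rfl
  -- The inverse copies the dual basis formula f = Σ aᵢ cᵢ(f).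
  let χ : V →+ R ⊗[R'] N :=
    { toFun := fun x => ∑ i, a i ⊗ₜ[R'] (⟨c i • x, hmem i x⟩ : N)
      map_zero' := Finset.sum_eq_zero fun i _ => by
        rw [show (⟨c i • (0 : V), hmem i 0⟩ : N) = 0 from Subtype.ext (smul_zero _),
          TensorProduct.tmul_zero]
      map_add' := fun x y => by
        rw [← Finset.sum_add_distrib]
        refine Finset.sum_congr rfl fun i _ => ?_
        rw [← TensorProduct.tmul_add]
        congr 1
        exact Subtype.ext (smul_add _ _ _) }
  have hχ : ∀ x, χ x = ∑ i, a i ⊗ₜ[R'] (⟨c i • x, hmem i x⟩ : N) := fun _ => rfl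
  refine ⟨N, ψ.toAddMonoidHom, ⟨?_, ?_⟩, ?_⟩
  · refine Function.LeftInverse.injective (g := χ) fun z => ?_
    change χ (ψ z) = z
    induction z with
    | zero => simp
    | add y z hy hz => rw [map_add, map_add, hy, hz]
    | tmul r x =>
      rw [hψ, hχ]
      conv_rhs => rw [← D.sum_mul r, TensorProduct.sum_tmul]
      refine Finset.sum_congr rfl fun i _ => ?_
      obtain ⟨k, hk⟩ := D.exists_algebraMap i r
      have : (⟨c i • (r • (1 : H)) • (x : V), hmem i _⟩ : N) = k • x := by
        refine Subtype.ext ?_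
        rw [Submodule.coe_smul, hV, ← hk]
        exact (hN (c i) r x).symm
      rw [this, hk, mul_comm, ← Algebra.smul_def, TensorProduct.smul_tmul]
  · intro x
    refine ⟨χ x, ?_⟩
    change ψ (χ x) = x
    rw [hχ, map_sum]
    have h1 := D.eq_sum 1
    simp only [map_one, Module.End.one_apply] at h1
    conv_rhs => rw [← one_smul H x, h1, Finset.sum_smul]
    refine Finset.sum_congr rfl fun i _ => ?_
    rw [hψ, ← mul_smul, smul_one_mul]
  · intro h z
    change ψ _ = h • ψ z
    induction z with
    | zero => simp
    | add y z hy hz => rw [map_add, map_add, hy, hz, map_add, smul_add]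
    | tmul r x => rw [LinearMap.rTensor_tmul, hψ, hψ, hN]

end

section

variable {R' R H : Type u} [CommRing R'] [CommRing R] [Algebra R' R] [Ring H] [Module R H]
  [IsScalarTower R H H] {ρ : H →+* Module.End R' R} {n : ℕ} {a : Fin n → R} {c : Fin n → H}
  {e : H} {τ : R →ₗ[R'] R'}

theorem isEquivalence_repTensor (D : IsDualBasisRep ρ a c) (E : IsRetractionRep ρ e τ) :
    (repTensor ρ).IsEquivalence where
  faithful := ⟨fun {N N'} f g h => by
    refine ModuleCat.hom_ext (LinearMap.ext fun x => ?_)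
    have h1 : f.hom.lTensor R ((1 : R) ⊗ₜ[R'] x) = g.hom.lTensor R ((1 : R) ⊗ₜ[R'] x) :=
      congrArg (fun φ => ModuleCat.Hom.hom φ ((1 : R) ⊗ₜ[R'] x)) h
    rw [LinearMap.lTensor_tmul, LinearMap.lTensor_tmul] at h1
    rw [← E.lid_rTensor_one_tmul (f.hom x), h1, E.lid_rTensor_one_tmul]⟩
  full := ⟨fun {N N'} φ => by
    obtain ⟨f, hf⟩ := exists_lTensor_eq D E (N := N) (N' := N')
      (ModuleCat.Hom.hom φ).toAddMonoidHom (fun h z => (ModuleCat.Hom.hom φ).map_smul h z)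
    exact ⟨ModuleCat.ofHom f, ModuleCat.hom_ext (LinearMap.ext fun z => (hf z).symm)⟩⟩
  essSurj := ⟨fun V => by
    let _ : Module R' V :=
      Module.compHom V ((RingHom.smulOneHom : R →+* H).comp (algebraMap R' R))
    obtain ⟨N, ψ, hψ, hequiv⟩ := exists_equivariant_equiv D E (V := V) (fun r x => rfl)
    let ψ' : (repTensor ρ).obj (ModuleCat.of R' N) →ₗ[H] V :=
      { toFun := ψ
        map_add' := ψ.map_add
        map_smul' := hequiv }
    exact ⟨ModuleCat.of R' N, ⟨(LinearEquiv.ofBijective ψ' hψ).toModuleIso⟩⟩⟩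

end

end IsRetractionRep

/-! ### Base change as a symmetric monoidal functor -/

noncomputable section

namespace IsDualBasisRep

variable {R' R H : Type u} [CommRing R'] [CommRing R] [Algebra R' R] [Ring H] [Module R H]
  [IsScalarTower R H H] {ρ : H →+* Module.End R' R} {n : ℕ} {a : Fin n → R} {c : Fin n → H}
  (D : IsDualBasisRep ρ a c)

/-- The functor `N ↦ R ⊗[R'] N`. -/
abbrev baseChange : ModuleCat.{u} R' ⥤ D.bialgebroid.Mod := D.bialgebroid.repTensor ρ

/-- The `R`-action on `R ⊗[R'] N` obtained through `H` is the usual one. -/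
def baseChangeEquiv (N : ModuleCat.{u} R') :
    (R ⊗[R'] N) ≃ₗ[R] D.bialgebroid.res.obj (D.baseChange.obj N) where
  toFun z := z
  invFun z := z
  left_inv _ := rfl
  right_inv _ := rfl
  map_add' _ _ := rfl
  map_smul' r z := (D.rTensor_smul_one r z).symm

theorem smul_baseChangeEquiv (N : ModuleCat.{u} R') (h : H) (z : R ⊗[R'] N) :
    h • D.baseChangeEquiv N z = D.baseChangeEquiv N ((ρ h).rTensor N z) := rfl

/-- Morphisms out of `R ⊗[R'] N` are determined by their values on the elements `1 ⊗ x`. -/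
theorem baseChange_hom_ext {N : ModuleCat.{u} R'} {Z : D.bialgebroid.Mod}
    {f g : D.baseChange.obj N ⟶ Z}
    (h : ∀ x : N, D.bialgebroid.res.map f (D.baseChangeEquiv N ((1 : R) ⊗ₜ[R'] x)) =
      D.bialgebroid.res.map g (D.baseChangeEquiv N ((1 : R) ⊗ₜ[R'] x))) : f = g := by
  refine D.bialgebroid.res.map_injective (ModuleCat.hom_ext (LinearMap.ext fun z => ?_))
  obtain ⟨z, rfl⟩ := (D.baseChangeEquiv N).surjective z
  induction z with
  | zero => simp only [map_zero]
  | add y z hy hz => simp only [map_add, hy, hz]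
  | tmul r x =>
    have e : r ⊗ₜ[R'] x = r • ((1 : R) ⊗ₜ[R'] x) := by
      rw [TensorProduct.smul_tmul', smul_eq_mul, mul_one]
    rw [e, map_smul, map_smul, map_smul]
    exact congrArg (r • ·) (h x)

theorem baseChange_tensor_hom_ext {N N' : ModuleCat.{u} R'} {Z : D.bialgebroid.Mod}
    {f g : D.baseChange.obj (N ⊗ N') ⟶ Z}
    (h : ∀ (x : N) (y : N'),
      D.bialgebroid.res.map f (D.baseChangeEquiv (N ⊗ N') ((1 : R) ⊗ₜ[R'] (x ⊗ₜ[R'] y))) =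
      D.bialgebroid.res.map g (D.baseChangeEquiv (N ⊗ N') ((1 : R) ⊗ₜ[R'] (x ⊗ₜ[R'] y)))) :
    f = g := by
  refine D.baseChange_hom_ext fun z => ?_
  change N ⊗[R'] N' at z
  induction z with
  | zero =>
    rw [TensorProduct.tmul_zero]
    simp only [map_zero]
  | add y z hy hz =>
    rw [TensorProduct.tmul_add]
    simp only [map_add, hy, hz]
  | tmul x y => exact h x y

/-- `(R ⊗[R'] N) ⊗[R] (R ⊗[R'] N') ≃ R ⊗[R'] (N ⊗[R'] N')`. -/
def baseChangeTensorEquiv (N N' : ModuleCat.{u} R') :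
    D.bialgebroid.res.obj (D.baseChange.obj N ⊗ D.baseChange.obj N') ≃ₗ[R]
      D.bialgebroid.res.obj (D.baseChange.obj (N ⊗ N')) :=
  (D.bialgebroid.tensorResEquiv _ _).symm ≪≫ₗ
    TensorProduct.congr (D.baseChangeEquiv N).symm (D.baseChangeEquiv N').symm ≪≫ₗ
    (AlgebraTensorModule.distribBaseChange R' R N N').symm ≪≫ₗ D.baseChangeEquiv (N ⊗ N')

theorem baseChangeTensorEquiv_tmul (N N' : ModuleCat.{u} R') (z : R ⊗[R'] N) (z' : R ⊗[R'] N') :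
    D.baseChangeTensorEquiv N N' (D.bialgebroid.tensorResEquiv _ _
      (D.baseChangeEquiv N z ⊗ₜ D.baseChangeEquiv N' z')) =
    D.baseChangeEquiv (N ⊗ N')
      ((AlgebraTensorModule.distribBaseChange R' R N N').symm (z ⊗ₜ z')) := rfl

/-- On (r ⊗ x) ⊗ (r' ⊗ y) an element of H ⊗ H acts through its pairing with r and r', and the
coproduct of h pairs to ρ(h)(r r'). -/
theorem baseChangeTensorEquiv_smul (N N' : ModuleCat.{u} R') (h : H)
    (w : D.bialgebroid.res.obj (D.baseChange.obj N ⊗ D.baseChange.obj N')) :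
    D.baseChangeTensorEquiv N N' (h • w) = h • D.baseChangeTensorEquiv N N' w := by
  refine D.bialgebroid.tensor_equivariant (D.baseChangeTensorEquiv N N').toModuleIso.hom
    (fun h x y => ?_) h w
  change D.baseChangeTensorEquiv N N' (h • D.bialgebroid.tensorResEquiv _ _ (x ⊗ₜ y)) =
    h • D.baseChangeTensorEquiv N N' (D.bialgebroid.tensorResEquiv _ _ (x ⊗ₜ y))
  obtain ⟨x, rfl⟩ := (D.baseChangeEquiv N).surjective x
  obtain ⟨y, rfl⟩ := (D.baseChangeEquiv N').surjective y
  induction x with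
  | zero => simp only [map_zero, TensorProduct.zero_tmul, smul_zero]
  | add x x' hx hx' => simp only [map_add, TensorProduct.add_tmul, smul_add, hx, hx']
  | tmul r x =>
    induction y with
    | zero => simp only [map_zero, TensorProduct.tmul_zero, smul_zero]
    | add y y' hy hy' => simp only [map_add, TensorProduct.tmul_add, smul_add, hy, hy']
    | tmul r' y =>
      have key : ∀ u : H ⊗[R] H, D.baseChangeTensorEquiv N N' (D.bialgebroid.tensorResEquiv _ _
          (TensorProduct.map (orbitMap R H (D.baseChangeEquiv N (r ⊗ₜ x)))
            (orbitMap R H (D.baseChangeEquiv N' (r' ⊗ₜ y))) u)) =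
          D.baseChangeEquiv (N ⊗ N') (D.pairing r r' u ⊗ₜ[R'] (x ⊗ₜ[R'] y)) := by
        intro u
        induction u with
        | zero =>
          rw [map_zero, map_zero, map_zero, map_zero, TensorProduct.zero_tmul, map_zero]
        | add u v hu hv =>
          rw [map_add, map_add, map_add, map_add, TensorProduct.add_tmul, map_add, hu, hv]
        | tmul u v =>
          rw [TensorProduct.map_tmul, orbitMap_apply, orbitMap_apply, smul_baseChangeEquiv,
            smul_baseChangeEquiv, baseChangeTensorEquiv_tmul, LinearMap.rTensor_tmul,
            LinearMap.rTensor_tmul, AlgebraTensorModule.distribBaseChange_symm_tmul, pairing_tmul]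
      rw [Bialgebroid.smul_tensorResEquiv, key, bialgebroid_comul, pairing_comul,
        baseChangeTensorEquiv_tmul, AlgebraTensorModule.distribBaseChange_symm_tmul]
      exact (D.smul_baseChangeEquiv (N ⊗ N') h ((r * r') ⊗ₜ[R'] (x ⊗ₜ[R'] y))).symm

/-- The tensorator of the functor `N ↦ R ⊗[R'] N`. -/
def baseChangeTensorIso (N₁ N₂ : ModuleCat.{u} R') :
    D.baseChange.obj N₁ ⊗ D.baseChange.obj N₂ ≅ D.baseChange.obj (N₁ ⊗ N₂) :=
  D.bialgebroid.liftIso (D.baseChangeTensorEquiv N₁ N₂).toModuleIso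
    (D.baseChangeTensorEquiv_smul N₁ N₂)

/-- The isomorphism of `R` with its tensor product with the base ring. -/
def baseChangeUnitEquiv :
    D.bialgebroid.res.obj (𝟙_ D.bialgebroid.Mod) ≃ₗ[R]
      D.bialgebroid.res.obj (D.baseChange.obj (𝟙_ (ModuleCat.{u} R'))) :=
  D.bialgebroid.unitResEquiv.symm ≪≫ₗ (AlgebraTensorModule.rid R' R R).symm ≪≫ₗ
    D.baseChangeEquiv (𝟙_ (ModuleCat.{u} R'))

theorem baseChangeUnitEquiv_smul (h : H) (w : D.bialgebroid.res.obj (𝟙_ D.bialgebroid.Mod)) :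
    D.baseChangeUnitEquiv (h • w) = h • D.baseChangeUnitEquiv w := by
  obtain ⟨r, rfl⟩ := D.bialgebroid.unitResEquiv.surjective w
  have h1 : h • D.bialgebroid.unitResEquiv r = D.bialgebroid.unitResEquiv (ρ h r) := by
    change ρ (h * (r • (1 : H))) 1 = ρ h r
    rw [D.mul_smul_one_apply, mul_one]
  rw [h1]
  rfl

/-- The unit comparison of the functor `N ↦ R ⊗[R'] N`. -/
def baseChangeUnitIso :
    𝟙_ D.bialgebroid.Mod ≅ D.baseChange.obj (𝟙_ (ModuleCat.{u} R')) :=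
  D.bialgebroid.liftIso D.baseChangeUnitEquiv.toModuleIso D.baseChangeUnitEquiv_smul

/-- With the tensorators inverted, both sides start at a base-changed module, so they need only be
compared on 1 ⊗ ((x ⊗ y) ⊗ z). -/
theorem baseChange_associativity (X Y Z : ModuleCat.{u} R') :
    (D.baseChangeTensorIso (X ⊗ Y) Z).inv ≫
        (D.baseChangeTensorIso X Y).inv ▷ D.baseChange.obj Z ≫
        (α_ (D.baseChange.obj X) (D.baseChange.obj Y) (D.baseChange.obj Z)).hom =
      D.baseChange.map (α_ X Y Z).hom ≫ (D.baseChangeTensorIso X (Y ⊗ Z)).inv ≫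
        D.baseChange.obj X ◁ (D.baseChangeTensorIso Y Z).inv := by
  refine D.baseChange_tensor_hom_ext fun w z => ?_
  change X ⊗[R'] Y at w
  induction w with
  | zero => rw [TensorProduct.zero_tmul, TensorProduct.tmul_zero]; simp only [map_zero]
  | add w w' hw hw' =>
    rw [TensorProduct.add_tmul, TensorProduct.tmul_add]
    simp only [map_add, hw, hw']
  | tmul x y => rfl

theorem baseChange_left_unitality (X : ModuleCat.{u} R') :
    (λ_ (D.baseChange.obj X)).inv = D.baseChange.map (λ_ X).inv ≫
      (D.baseChangeTensorIso (𝟙_ _) X).inv ≫ D.baseChangeUnitIso.inv ▷ D.baseChange.obj X := by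
  refine D.baseChange_hom_ext fun x => ?_
  change D.bialgebroid.tensorResEquiv (𝟙_ D.bialgebroid.Mod) (D.baseChange.obj X)
      (D.bialgebroid.unitResEquiv 1 ⊗ₜ D.baseChangeEquiv X ((1 : R) ⊗ₜ[R'] x)) =
    D.bialgebroid.tensorResEquiv (𝟙_ D.bialgebroid.Mod) (D.baseChange.obj X)
      (D.bialgebroid.unitResEquiv ((1 : R') • (1 : R)) ⊗ₜ
        D.baseChangeEquiv X ((1 : R) ⊗ₜ[R'] x))
  rw [one_smul]

theorem baseChange_right_unitality (X : ModuleCat.{u} R') :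
    (ρ_ (D.baseChange.obj X)).inv = D.baseChange.map (ρ_ X).inv ≫
      (D.baseChangeTensorIso X (𝟙_ _)).inv ≫ D.baseChange.obj X ◁ D.baseChangeUnitIso.inv := by
  refine D.baseChange_hom_ext fun x => ?_
  change D.bialgebroid.tensorResEquiv (D.baseChange.obj X) (𝟙_ D.bialgebroid.Mod)
      (D.baseChangeEquiv X ((1 : R) ⊗ₜ[R'] x) ⊗ₜ D.bialgebroid.unitResEquiv 1) =
    D.bialgebroid.tensorResEquiv (D.baseChange.obj X) (𝟙_ D.bialgebroid.Mod)
      (D.baseChangeEquiv X ((1 : R) ⊗ₜ[R'] x) ⊗ₜ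
        D.bialgebroid.unitResEquiv ((1 : R') • (1 : R)))
  rw [one_smul]

instance monoidalBaseChange : D.baseChange.Monoidal :=
  Functor.CoreMonoidal.toMonoidal <|
    .mk' (F := D.baseChange) D.baseChangeUnitIso D.baseChangeTensorIso
      (fun _ _ => D.baseChange_tensor_hom_ext fun _ _ => rfl)
      (fun _ _ => D.baseChange_tensor_hom_ext fun _ _ => rfl)
      D.baseChange_associativity D.baseChange_left_unitality D.baseChange_right_unitality

theorem baseChange_braided [D.bialgebroid.IsCocomm] (X Y : ModuleCat.{u} R') :
    (D.baseChangeTensorIso X Y).hom ≫ D.baseChange.map (β_ X Y).hom =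
      (β_ (D.baseChange.obj X) (D.baseChange.obj Y)).hom ≫ (D.baseChangeTensorIso Y X).hom := by
  -- Again both tensorators are inverted, so that it suffices to test on 1 ⊗ (x ⊗ y).
  rw [← Iso.eq_inv_comp, ← Category.assoc, ← Iso.comp_inv_eq]
  exact D.baseChange_tensor_hom_ext fun x y => rfl

instance braidedBaseChange [D.bialgebroid.IsCocomm] : D.baseChange.Braided where
  braided := D.baseChange_braided

end IsDualBasisRep

end

/-! ### The main theorem -/

theorem mainTheorem3 {B : Type u} {M : CoxeterMatrix B} {W : Type v} [Group W] [Finite W]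
    (cs : CoxeterSystem M W) :
    ∃ (ρ : NilHecke M →ₐ[ℝ] Module.End (invariants cs) (SymR B))
      (bd : Bialgebroid (SymR B) (NilHecke M)) (_ : bd.IsCocomm),
      (∀ (l : B →₀ ℝ) (f : SymR B),
        ρ (NilHecke.weight M l) f = SymmetricAlgebra.ι ℝ (B →₀ ℝ) l * f) ∧
      (∀ (s : B) (f : SymR B),
        SymmetricAlgebra.ι ℝ (B →₀ ℝ) (simpleRoot s) * ρ (NilHecke.del M s) f =
          f - symAction cs (cs.simple s) f) ∧
      (∀ l : B →₀ ℝ, bd.comul (NilHecke.weight M l) = NilHecke.weight M l ⊗ₜ[SymR B] 1) ∧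
      (∀ s : B, bd.comul (NilHecke.del M s) =
        NilHecke.del M s ⊗ₜ[SymR B] NilHecke.reflElt M s + 1 ⊗ₜ[SymR B] NilHecke.del M s) ∧
      (∀ h : NilHecke M, bd.counit h = ρ h 1) ∧
      Function.Bijective ρ ∧
      (∀ (h : NilHecke M) (n : ℕ) (x y : Fin n → NilHecke M),
        bd.comul h = ∑ i, x i ⊗ₜ[SymR B] y i →
          ∀ f g : SymR B, ρ h (f * g) = ∑ i, ρ (x i) f * ρ (y i) g) ∧
      (bd.repTensor ρ.toRingHom).IsEquivalence ∧
      Nonempty (bd.repTensor ρ.toRingHom).Braided := by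
  obtain ⟨n, a, c, e, hc, hexp, he, he1⟩ := exists_dualBasis cs
  have D : IsDualBasisRep (nilHeckeRep cs).toRingHom a c :=
    { smul_apply := nilHeckeRep_smul cs
      exists_algebraMap := fun i f => ⟨⟨_, hc i f⟩, rfl⟩
      eq_sum := hexp }
  -- The operator of `e`, with its codomain restricted to the invariants.
  let τ : SymR B →ₗ[invariants cs] invariants cs :=
    { toFun := fun f => ⟨nilHeckeRep cs e f, he f⟩
      map_add' := fun f g => Subtype.ext (map_add (nilHeckeRep cs e) f g)
      map_smul' := fun r f => Subtype.ext (map_smul (nilHeckeRep cs e) r f) }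
  have E : IsRetractionRep (nilHeckeRep cs).toRingHom e τ :=
    { apply_eq := fun f => rfl
      apply_one := Subtype.ext he1 }
  have hcocomm := D.isCocomm_bialgebroid
  have hρ : ∀ h, (nilHeckeRep cs).toRingHom h = nilHeckeRep cs h := fun _ => rfl
  refine ⟨nilHeckeRep cs, D.bialgebroid, hcocomm, fun l f => ?_, fun s f => ?_, fun l => ?_,
    fun s => ?_, fun h => rfl, ⟨D.injective, D.surjective⟩, fun h n x y hxy f g => ?_,
    E.isEquivalence_repTensor D, ⟨D.braidedBaseChange⟩⟩
  · rw [nilHeckeRep_weight, weightMul_apply]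
  · rw [nilHeckeRep_del, ι_mul_demazure]
  · refine D.pairing_ext fun f g => ?_
    rw [D.bialgebroid_comul, D.pairing_comul, D.pairing_tmul, hρ, hρ, nilHeckeRep_weight, map_one,
      weightMul_apply, weightMul_apply, Module.End.one_apply, mul_assoc]
  -- Under the pairing, the formula for Δ(∂ₛ) is `demazure_mul`.
  · refine D.pairing_ext fun f g => ?_
    rw [D.bialgebroid_comul, D.pairing_comul, map_add, D.pairing_tmul, D.pairing_tmul, hρ, hρ, hρ,
      nilHeckeRep_del, map_one, nilHeckeRep_reflElt, demazure_mul, Module.End.one_apply]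
  · rw [← hρ, ← D.pairing_comul, ← D.bialgebroid_comul, hxy, map_sum]
    exact Finset.sum_congr rfl fun i _ => D.pairing_tmul f g (x i) (y i)
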